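/- Let $a,b,c,d\in\mathbb R$, put $\delta=c+d-a-b$, and assume that $a,b,\delta>0$, that $c,d\notin-\mathbb N_0$, and that $d-a,\ d-b,\ c+1-a,\ c-b\notin-\mathbb N_0$, where $-\mathbb N_0=\{0,-1,-2,\dots\}$. For $0<x<1$ let $$\mathscr w(x,a,b;c,d)=\frac{\Gamma(c)\Gamma(d)}{\Gamma(a)\Gamma(b)\Gamma(\delta)}\,x^{a-1}(1-x)^{\delta-1}\,{}_2F_1\!\left[{c-b,\;d-b\atop \delta};1-x\right],$$ and put $W_1(x)=\mathscr w(x,a,b;c,d)$ and $W_2(x)=\mathscr w(x,a,b+1;c+1,d)$. Then, for every $n\in\mathbb N_0$, there is exactly one monic polynomial $B^{(n)}$ of degree $n$ (the type II hypergeometric multiple orthogonal polynomial on the step-line) such that $$\int_0^1B^{(n)}(x)\,x^kW_1(x)\,dx=0\quad\Big(0\le k<\lceil n/2\rceil\Big),\qquad \int_0^1B^{(n)}(x)\,x^kW_2(x)\,dx=0\quad\Big(0\le k<\lfloor n/2\rfloor\Big),$$ and $$\lim_{n\to\infty}\frac{B^{(n+1)}(1)}{B^{(n)}(1)}=\frac{8}{27}=2\kappa,\qquad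 \kappa=\frac4{27}.$$ Moreover, $$\lim_{n\to\infty}\frac{{}_3F_2\!\left[{-2n-2,\;c+n+1,\;d+n\atop a,\;b};1\right]}{{}_3F_2\!\left[{-2n-1,\;c+n,\;d+n\atop a,\;b};1\right]}=-2 .$$ -/

import Mathlib

open Filter Topology Polynomial

/-- The function
`𝓌(x, a, b; c, d) = Γ(c)Γ(d) / (Γ(a)Γ(b)Γ(δ)) x^(a-1) (1-x)^(δ-1) ₂F₁(c-b, d-b; δ; 1-x)`,
where `δ = c + d - a - b`, for `0 < x < 1`. -/
noncomputable def hypWeight (a b c d x : ℝ) : ℝ :=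
  Real.Gamma c * Real.Gamma d / (Real.Gamma a * Real.Gamma b * Real.Gamma (c + d - a - b)) *
    x ^ (a - 1) * (1 - x) ^ (c + d - a - b - 1) *
    ordinaryHypergeometric (c - b) (d - b) (c + d - a - b) (1 - x)

/-- The first weight, `W₁(x) = 𝓌(x, a, b; c, d)`. -/
noncomputable def hypW1 (a b c d x : ℝ) : ℝ := hypWeight a b c d x

/-- The second weight, `W₂(x) = 𝓌(x, a, b + 1; c + 1, d)`. -/
noncomputable def hypW2 (a b c d x : ℝ) : ℝ := hypWeight a (b + 1) (c + 1) d x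

/-- `P` is an `n`-th type II multiple orthogonal polynomial on the step-line for the system
`(W₁, W₂, dx)` on `[0, 1]`: it is monic of degree `n`, and orthogonal to `x ^ k` with respect to
`W₁` for `k < ⌈n/2⌉` and with respect to `W₂` for `k < ⌊n/2⌋`. That is, the multi-index is
`(m, m)` for `n = 2m` and `(m + 1, m)` for `n = 2m + 1`. -/
structure IsTypeII (a b c d : ℝ) (n : ℕ) (P : ℝ[X]) : Prop where
  monic : P.Monic
  natDegree_eq : P.natDegree = n
  orthogonal_W1 : ∀ k : ℕ, k < (n + 1) / 2 →
    ∫ x in (0 : ℝ)..1, P.eval x * x ^ k * hypW1 a b c d x = 0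
  orthogonal_W2 : ∀ k : ℕ, k < n / 2 →
    ∫ x in (0 : ℝ)..1, P.eval x * x ^ k * hypW2 a b c d x = 0

/-- The generalized hypergeometric series `₃F₂(a₁, a₂, a₃; b₁, b₂; x)`. -/
noncomputable def hyp3F2 (a₁ a₂ a₃ b₁ b₂ x : ℝ) : ℝ :=
  ∑' k : ℕ, (ascPochhammer ℝ k).eval a₁ * (ascPochhammer ℝ k).eval a₂ *
    (ascPochhammer ℝ k).eval a₃ /
      ((ascPochhammer ℝ k).eval b₁ * (ascPochhammer ℝ k).eval b₂) * (x ^ k / (k.factorial : ℝ))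

/-! Expanding the ₂F₁ in the weight and integrating termwise turns each moment into a Beta value
times a Gauss series at 1. A contiguous relation for that series shows that the moments of W₁ are
(a)ₖ(b)ₖ/((c)ₖ(d)ₖ) up to a constant; W₂ is the same with b+1, c+1. The candidate polynomial is E_N
= ₃F₂(-N, c+⌊N/2⌋, d+⌊(N-1)/2⌋; a, b; x). Against the i-th orthogonality condition the Pochhammer
symbols cancel. For i < N what remains is an N-th finite difference of a polynomial in j of degree
below N, hence 0. For i = N ≥ 1 one linear denominator survives, and the value is a product that the
conditions on d-a, d-b, c+1-a, c-b keep away from 0. So the matrix of conditions against the E_N is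
triangular with nonzero diagonal, which gives uniqueness; normalizing E_N gives existence.

At x = 1 the series alternates, so its size is hidden by cancellation. A terminating Thomae
transformation rewrites (b)_N E_N(1) as (-1)^N ∑ₖ tₖ, where tₖ = C(N,k)(-α)ₖ(-β)ₖ(δ)_{N-k}/(a)ₖ and
α, β = N/2 + O(1). Since tₖ₊₁/tₖ is roughly (N/2-k)²/k², the terms are positive and increasing up to
about N/4 and decay geometrically in absolute value afterwards, so the sum lives near k = N/4.
Passing from N to N+1 raises one of α, β by 1 and multiplies tₖ by
(N+1)(δ+N-k)(α+1)/((N+1-k)(α+1-k)) (or the same with β), about 2N at k ≈ N/4. Dividing by -(b+N)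
gives E_{N+1}(1)/E_N(1) → -2; the second limit is the subsequence N = 2n+1. The ratio of leading
coefficients tends to -(1/2)/(3/2)³ = -4/27, and the product of the two limits is 8/27. -/

/-! ### Rising factorials -/

/-- The rising factorial `(x)ₙ = x (x + 1) ⋯ (x + n - 1)`. -/
noncomputable abbrev poch (x : ℝ) (n : ℕ) : ℝ := (ascPochhammer ℝ n).eval x

theorem poch_zero (x : ℝ) : poch x 0 = 1 := by simp [poch]

theorem poch_succ (x : ℝ) (n : ℕ) : poch x (n + 1) = poch x n * (x + n) :=
  ascPochhammer_succ_eval n x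

theorem poch_succ' (x : ℝ) (n : ℕ) : poch x (n + 1) = x * poch (x + 1) n := by
  simp [poch, ascPochhammer_succ_left]

theorem poch_add (x : ℝ) (m n : ℕ) : poch x (m + n) = poch x m * poch (x + m) n := by
  simp [poch, ← ascPochhammer_mul]

theorem poch_pos {x : ℝ} (hx : 0 < x) (n : ℕ) : 0 < poch x n := ascPochhammer_pos n x hx

theorem poch_ne_zero {x : ℝ} (hx : ∀ k : ℕ, x ≠ -(k : ℝ)) (n : ℕ) : poch x n ≠ 0 := by
  rw [poch, Ne, ascPochhammer_eval_eq_zero_iff]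
  rintro ⟨k, -, hk⟩
  exact hx k (by linarith)

theorem poch_shift (x : ℝ) (n : ℕ) : poch (x + 1) n * x = poch x n * (x + n) := by
  rw [mul_comm, ← poch_succ', poch_succ]

/-! ### The Gauss series at 1: convergence, contiguity, nonvanishing -/

/-- The terms of the series `₂F₁(A, B; E; 1)`. -/
noncomputable def gaussTerm (A B E : ℝ) (j : ℕ) : ℝ :=
  poch A j * poch B j / (poch E j * (j.factorial : ℝ))

theorem gaussTerm_succ {A B E : ℝ} (hE : 0 < E) (j : ℕ) :
    ((j : ℝ) + 1) * gaussTerm A B E (j + 1) =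
      gaussTerm A B E j * ((A + j) * (B + j) / (E + j)) := by
  have h1 := (poch_pos hE j).ne'
  have h2 : (E + j) ≠ 0 := by positivity
  have h3 : (j.factorial : ℝ) ≠ 0 := by positivity
  simp only [gaussTerm, poch_succ, Nat.factorial_succ, Nat.cast_mul, Nat.cast_succ]
  field_simp

theorem gaussTerm_param_succ {A B E : ℝ} (hE : 0 < E) (j : ℕ) :
    gaussTerm A B (E + 1) j * (E + j) = gaussTerm A B E j * E := by
  have h1 := (poch_pos hE j).ne'
  have h1' := (poch_pos (show 0 < E + 1 by linarith) j).ne'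
  have h3 : (j.factorial : ℝ) ≠ 0 := by positivity
  have h := poch_shift E j
  simp only [gaussTerm]
  field_simp
  linear_combination (-(poch A j * poch B j)) * h

/-- Raabe's test, together with the vanishing of `n vₙ`. -/
theorem summable_of_raabe {v : ℕ → ℝ} {s : ℝ} (hs : 0 < s) (hv : ∀ j, 0 ≤ v j)
    (h : ∀ᶠ j : ℕ in atTop, s * v j ≤ j * v j - ((j : ℝ) + 1) * v (j + 1)) :
    Summable v ∧ Tendsto (fun j : ℕ => (j : ℝ) * v j) atTop (𝓝 0) := by
  obtain ⟨n₀, hn₀⟩ := eventually_atTop.1 h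
  have hsum : Summable v := by
    rw [← summable_nat_add_iff n₀]
    refine summable_of_sum_range_le (c := s⁻¹ * (n₀ * v n₀)) (fun _ => hv _) fun n => ?_
    have key : ∀ n : ℕ, s * ∑ i ∈ Finset.range n, v (i + n₀) ≤
        n₀ * v n₀ - (n + n₀ : ℕ) * v (n + n₀) := by
      intro n
      induction n with
      | zero => simp
      | succ n ih =>
        rw [Finset.sum_range_succ, mul_add]
        have := hn₀ (n + n₀) (by omega)
        rw [show n + 1 + n₀ = n + n₀ + 1 by ring]
        push_cast at this ih ⊢
        linarith
    rw [← div_eq_inv_mul, le_div_iff₀ hs, mul_comm]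
    refine (key n).trans ?_
    have := mul_nonneg (Nat.cast_nonneg (α := ℝ) (n + n₀)) (hv (n + n₀))
    linarith
  refine ⟨hsum, ?_⟩
  have hanti : Antitone fun j : ℕ => ((j + n₀ : ℕ) : ℝ) * v (j + n₀) := by
    refine antitone_nat_of_succ_le fun j => ?_
    have := hn₀ (j + n₀) (by omega)
    have h0 := mul_nonneg hs.le (hv (j + n₀))
    rw [show j + 1 + n₀ = j + n₀ + 1 by ring]
    push_cast at this ⊢
    linarith
  have hbdd : BddBelow (Set.range fun j : ℕ => ((j + n₀ : ℕ) : ℝ) * v (j + n₀)) :=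
    ⟨0, by rintro _ ⟨j, rfl⟩; exact mul_nonneg (Nat.cast_nonneg _) (hv _)⟩
  have hlim := tendsto_atTop_ciInf hanti hbdd
  set l := ⨅ j : ℕ, ((j + n₀ : ℕ) : ℝ) * v (j + n₀) with hl
  have hl0 : 0 ≤ l := le_ciInf fun j => mul_nonneg (Nat.cast_nonneg _) (hv _)
  -- The sequence j vⱼ decreases to l; if l were positive, vⱼ ≥ l/j would contradict the divergence
  -- of the harmonic series.
  have hlz : l = 0 := by
    by_contra hne
    have hlpos : 0 < l := lt_of_le_of_ne hl0 (Ne.symm hne)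
    have h1 : Summable fun j : ℕ => l * (1 / ((j + n₀ : ℕ) : ℝ)) := by
      refine Summable.of_nonneg_of_le (fun j => by positivity) (fun j => ?_)
        ((summable_nat_add_iff n₀).2 hsum)
      have := ciInf_le hbdd j
      rcases (Nat.cast_nonneg (α := ℝ) (j + n₀)).eq_or_lt with h0 | h0
      · rw [← h0]; simpa using hv _
      · rw [mul_one_div, div_le_iff₀ h0, mul_comm (v _)]
        exact this
    rw [summable_mul_left_iff hlpos.ne'] at h1
    exact Real.not_summable_one_div_natCast
      ((summable_nat_add_iff (f := fun j : ℕ => 1 / (j : ℝ)) n₀).1 h1)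
  rw [hlz] at hlim
  exact (tendsto_add_atTop_iff_nat (f := fun j : ℕ => (j : ℝ) * v j) n₀).1 hlim

theorem gaussTerm_raabe {A B E : ℝ} (hE : 0 < E) (hs : 0 < E - A - B) :
    ∀ᶠ j : ℕ in atTop, (E - A - B) / 2 * |gaussTerm A B E j| ≤
      j * |gaussTerm A B E j| - ((j : ℝ) + 1) * |gaussTerm A B E (j + 1)| := by
  have hA : ∀ᶠ j : ℕ in atTop, 0 ≤ A + j :=
    (tendsto_atTop_add_const_left _ A tendsto_natCast_atTop_atTop).eventually_ge_atTop 0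
  have hB : ∀ᶠ j : ℕ in atTop, 0 ≤ B + j :=
    (tendsto_atTop_add_const_left _ B tendsto_natCast_atTop_atTop).eventually_ge_atTop 0
  -- With s = E-A-B, (A+j)(B+j)/(E+j) = j - s + O(1/j); this threshold is exactly what (A+j)(B+j) ≤
  -- (j - s/2)(E+j) requires.
  have hbig : ∀ᶠ j : ℕ in atTop, E + 2 * A * B / (E - A - B) ≤ j :=
    tendsto_natCast_atTop_atTop.eventually_ge_atTop _
  filter_upwards [hA, hB, hbig] with j hA hB hbig
  have hEj : 0 < E + j := by positivity
  have h1 : ((j : ℝ) + 1) * |gaussTerm A B E (j + 1)| =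
      |gaussTerm A B E j| * ((A + j) * (B + j) / (E + j)) := by
    rw [← abs_of_nonneg (show (0 : ℝ) ≤ (A + j) * (B + j) / (E + j) by positivity), ← abs_mul,
      ← gaussTerm_succ hE, abs_mul, abs_of_nonneg (show (0 : ℝ) ≤ (j : ℝ) + 1 by positivity)]
  rw [h1]
  have h2 : (A + j) * (B + j) / (E + j) ≤ j - (E - A - B) / 2 := by
    rw [div_le_iff₀ hEj]
    have h3 : E * (E - A - B) + 2 * A * B ≤ j * (E - A - B) := by
      have := mul_le_mul_of_nonneg_right hbig hs.le
      rwa [add_mul, div_mul_cancel₀ _ hs.ne'] at this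
    nlinarith
  nlinarith [abs_nonneg (gaussTerm A B E j)]

theorem summable_abs_gaussTerm {A B E : ℝ} (hE : 0 < E) (hs : 0 < E - A - B) :
    Summable fun j => |gaussTerm A B E j| :=
  (summable_of_raabe (half_pos hs) (fun _ => abs_nonneg _) (gaussTerm_raabe hE hs)).1

/-- The value `₂F₁(A, B; E; 1)`. -/
noncomputable def hypGaussSum (A B E : ℝ) : ℝ := ∑' j, gaussTerm A B E j

/-- The difference of the two series telescopes: its n-th partial sum is -E·n·tₙ, which vanishes in
the limit by the second half of `summable_of_raabe`. This replaces Gauss's evaluation in Gamma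
functions. -/
theorem hypGaussSum_contiguous {A B E : ℝ} (hE : 0 < E) (hs : 0 < E - A - B) :
    E * (E - A - B) * hypGaussSum A B E = (E - A) * (E - B) * hypGaussSum A B (E + 1) := by
  have h0 := (summable_of_raabe (half_pos hs) (fun _ => abs_nonneg _) (gaussTerm_raabe hE hs)).2
  have h1 : Tendsto (fun j : ℕ => E * (j * gaussTerm A B E j)) atTop (𝓝 0) := by
    have : Tendsto (fun j : ℕ => (j : ℝ) * gaussTerm A B E j) atTop (𝓝 0) := by
      rw [tendsto_zero_iff_abs_tendsto_zero]
      refine h0.congr fun j => ?_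
      simp [abs_mul]
    simpa using this.const_mul E
  have hS := (summable_abs_gaussTerm hE hs).of_abs.hasSum
  have hS' := (summable_abs_gaussTerm (A := A) (B := B) (show 0 < E + 1 by linarith)
    (by linarith)).of_abs.hasSum
  have hD := ((hS.mul_left (E * (E - A - B))).sub (hS'.mul_left ((E - A) * (E - B)))).tendsto_sum_nat
  have hT : ∀ n : ℕ, ∑ j ∈ Finset.range n, (E * (E - A - B) * gaussTerm A B E j -
      (E - A) * (E - B) * gaussTerm A B (E + 1) j) = -(E * (n * gaussTerm A B E n)) := by
    intro n
    induction n with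
    | zero => simp
    | succ n ih =>
      have hEn : E + n ≠ 0 := by positivity
      rw [Finset.sum_range_succ, ih, Nat.cast_succ, gaussTerm_succ hE,
        eq_div_of_mul_eq hEn (gaussTerm_param_succ (A := A) (B := B) hE n)]
      field_simp
      ring
  simp_rw [hT] at hD
  have := tendsto_nhds_unique hD h1.neg
  simp only [hypGaussSum]
  linarith

theorem poch_le_poch {x y : ℝ} (hx : 0 < x) (hxy : x ≤ y) (n : ℕ) : poch x n ≤ poch y n := by
  induction n with
  | zero => simp [poch]
  | succ n ih =>
    rw [poch_succ, poch_succ]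
    have := (poch_pos hx n).le.trans ih
    gcongr

/-- Every term with j ≥ 1 dies as the lower parameter grows, and the series at E dominates. -/
theorem hypGaussSum_tendsto {A B E : ℝ} (hE : 0 < E) (hs : 0 < E - A - B) :
    Tendsto (fun m : ℕ => hypGaussSum A B (E + m)) atTop (𝓝 1) := by
  have h1 : (1 : ℝ) = ∑' j : ℕ, if j = 0 then (1 : ℝ) else 0 := by simp
  rw [h1]
  refine tendsto_tsum_of_dominated_convergence (summable_abs_gaussTerm hE hs) ?_ ?_
  · intro j
    rcases j with _ | j
    · simp [gaussTerm, poch]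
    · simp only [gaussTerm, Nat.succ_ne_zero, if_false]
      refine Tendsto.const_div_atTop ?_ _
      refine Tendsto.atTop_mul_const (by positivity) ?_
      refine tendsto_atTop_mono (f := fun m : ℕ => E * poch (E + 1) j + m * poch (E + 1) j)
        (fun m => ?_) ?_
      · rw [poch_succ', ← add_mul]
        have := poch_le_poch (show 0 < E + 1 by linarith)
          (show E + 1 ≤ E + m + 1 by linarith [Nat.cast_nonneg (α := ℝ) m]) j
        gcongr
      · exact tendsto_atTop_add_const_left _ _
          (tendsto_natCast_atTop_atTop.atTop_mul_const (poch_pos (by linarith) j))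
  · refine Eventually.of_forall fun m j => ?_
    have h2 := poch_pos hE j
    have h3 := poch_le_poch hE (show E ≤ E + m by linarith [Nat.cast_nonneg (α := ℝ) m]) j
    rw [Real.norm_eq_abs, gaussTerm, gaussTerm, abs_div, abs_div,
      abs_of_pos (show 0 < poch E j * (j.factorial : ℝ) by positivity),
      abs_of_pos (show 0 < poch (E + m) j * (j.factorial : ℝ) by
        have := h2.trans_le h3; positivity)]
    gcongr

/-- The contiguous relation would propagate a zero at E to every E+m, against the limit 1. -/
theorem hypGaussSum_ne_zero {A B E : ℝ} (hE : 0 < E) (hs : 0 < E - A - B)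
    (hA : ∀ k : ℕ, E - A ≠ -(k : ℝ)) (hB : ∀ k : ℕ, E - B ≠ -(k : ℝ)) :
    hypGaussSum A B E ≠ 0 := by
  intro h0
  have hm : ∀ m : ℕ, hypGaussSum A B (E + m) = 0 := by
    intro m
    induction m with
    | zero => simpa using h0
    | succ m ih =>
      have hm0 := Nat.cast_nonneg (α := ℝ) m
      have := hypGaussSum_contiguous (A := A) (B := B) (E := E + m) (by linarith) (by linarith)
      rw [ih, mul_zero, eq_comm, mul_eq_zero, mul_eq_zero] at this
      rw [Nat.cast_succ, ← add_assoc]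
      rcases this with (h | h) | h
      · exact absurd (by linarith) (hA m)
      · exact absurd (by linarith) (hB m)
      · exact h
  have := hypGaussSum_tendsto (A := A) (B := B) hE hs
  simp_rw [hm] at this
  exact zero_ne_one (tendsto_nhds_unique tendsto_const_nhds this)

/-! ### Beta integrals and the moments of the weight -/

open MeasureTheory in
theorem setIntegral_beta {u v : ℝ} (hu : 0 < u) (hv : 0 < v) :
    ∫ x in Set.Ioo (0 : ℝ) 1, x ^ (u - 1) * (1 - x) ^ (v - 1) = ProbabilityTheory.beta u v := by
  rw [ProbabilityTheory.beta_eq_betaIntegralReal u v hu hv, Complex.betaIntegral,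
    intervalIntegral.integral_of_le (by norm_num), ← integral_Ioc_eq_integral_Ioo,
    ← RCLike.re_to_complex, ← integral_re]
  · refine setIntegral_congr_fun measurableSet_Ioc fun x ⟨hx1, hx2⟩ => ?_
    norm_cast
    rw [← Complex.ofReal_cpow, ← Complex.ofReal_cpow, RCLike.re_to_complex,
      Complex.re_mul_ofReal, Complex.ofReal_re]
    all_goals linarith
  convert! Complex.betaIntegral_convergent (u := u) (v := v) (by simpa) (by simpa)
  rw [intervalIntegrable_iff_integrableOn_Ioc_of_le (by simp), IntegrableOn]

open MeasureTheory in
theorem integrableOn_beta {u v : ℝ} (hu : 0 < u) (hv : 0 < v) :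
    IntegrableOn (fun x : ℝ => x ^ (u - 1) * (1 - x) ^ (v - 1)) (Set.Ioo 0 1) := by
  -- A non-integrable function has Bochner integral 0 by convention, so a nonzero value yields
  -- integrability. The same device gives integrability against the weight.
  refine Integrable.of_integral_ne_zero ?_
  rw [setIntegral_beta hu hv]
  exact (ProbabilityTheory.beta_pos hu hv).ne'

theorem Gamma_add_nat {x : ℝ} (hx : 0 < x) (n : ℕ) :
    Real.Gamma (x + n) = poch x n * Real.Gamma x := by
  induction n with
  | zero => simp [poch]
  | succ n ih =>
    rw [Nat.cast_succ, ← add_assoc, Real.Gamma_add_one (by positivity), ih, poch_succ]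
    ring

theorem beta_add_nat_right {u v : ℝ} (hu : 0 < u) (hv : 0 < v) (n : ℕ) :
    ProbabilityTheory.beta u (v + n) = ProbabilityTheory.beta u v * (poch v n / poch (u + v) n) := by
  have h1 := (poch_pos (add_pos hu hv) n).ne'
  have h2 := (Real.Gamma_pos_of_pos (add_pos hu hv)).ne'
  rw [ProbabilityTheory.beta, ProbabilityTheory.beta, ← add_assoc, Gamma_add_nat hv,
    Gamma_add_nat (add_pos hu hv)]
  field_simp

theorem beta_succ_left {u v : ℝ} (hu : 0 < u) (hv : 0 < v) :
    ProbabilityTheory.beta (u + 1) v * (u + v) = ProbabilityTheory.beta u v * u := by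
  have h2 := (Real.Gamma_pos_of_pos (add_pos hu hv)).ne'
  rw [ProbabilityTheory.beta, ProbabilityTheory.beta, Real.Gamma_add_one hu.ne',
    show u + 1 + v = u + v + 1 by ring, Real.Gamma_add_one (by positivity)]
  field_simp

/-- The moments of the weight `𝓌(x, a, b; c, d)`. -/
noncomputable def hypMoment (a b c d : ℝ) (k : ℕ) : ℝ :=
  ∫ x in (0 : ℝ)..1, x ^ k * hypWeight a b c d x

section Moments

variable {a b c d : ℝ} (ha : 0 < a) (hb : 0 < b) (hδ : 0 < c + d - a - b)

include ha hb hδ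

open MeasureTheory in
-- Termwise integration of the ₂F₁: the j-th term contributes a Beta value at (a+k, δ+j), and the
-- quotients of these rebuild a Gauss series with lower parameter a+k+δ. Its excess is b+k > 0, so
-- it converges absolutely and the interchange is legitimate.
theorem hypMoment_eq (k : ℕ) :
    hypMoment a b c d k =
      Real.Gamma c * Real.Gamma d / (Real.Gamma a * Real.Gamma b * Real.Gamma (c + d - a - b)) *
        ProbabilityTheory.beta (a + k) (c + d - a - b) *
        hypGaussSum (c - b) (d - b) (a + k + (c + d - a - b)) := by
  set δ := c + d - a - b with hδ_def
  set K := Real.Gamma c * Real.Gamma d / (Real.Gamma a * Real.Gamma b * Real.Gamma δ) with hK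
  have hu : 0 < a + k := by positivity
  let co : ℕ → ℝ := fun j => (j.factorial : ℝ)⁻¹ * poch (c - b) j * poch (d - b) j * (poch δ j)⁻¹
  let f : ℕ → ℝ → ℝ := fun j x =>
    K * co j * (x ^ (a + k - 1) * (1 - x) ^ (δ + j - 1))
  have hδj : ∀ j : ℕ, 0 < δ + j := fun j => by positivity
  have hco : ∀ j, co j * ProbabilityTheory.beta (a + k) (δ + j) =
      ProbabilityTheory.beta (a + k) δ * gaussTerm (c - b) (d - b) (a + k + δ) j := by
    intro j
    have h1 := (poch_pos hδ j).ne'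
    have h2 := (poch_pos (add_pos hu hδ) j).ne'
    have h3 : (j.factorial : ℝ) ≠ 0 := by positivity
    rw [beta_add_nat_right hu hδ]
    simp only [co, gaussTerm]
    field_simp
  have hint : ∀ j, Integrable (f j) (volume.restrict (Set.Ioo (0 : ℝ) 1)) := fun j =>
    (integrableOn_beta hu (hδj j)).const_mul _
  have hval : ∀ j, ∫ x in Set.Ioo (0 : ℝ) 1, f j x =
      K * ProbabilityTheory.beta (a + k) δ * gaussTerm (c - b) (d - b) (a + k + δ) j := by
    intro j
    simp only [f]
    rw [integral_const_mul, setIntegral_beta hu (hδj j), mul_assoc, hco, mul_assoc]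
  have hnorm : ∀ j, ∫ x in Set.Ioo (0 : ℝ) 1, ‖f j x‖ =
      |K| * ProbabilityTheory.beta (a + k) δ * |gaussTerm (c - b) (d - b) (a + k + δ) j| := by
    intro j
    have : ∀ x ∈ Set.Ioo (0 : ℝ) 1, ‖f j x‖ =
        |K * co j| * (x ^ (a + k - 1) * (1 - x) ^ (δ + j - 1)) := by
      intro x hx
      have h1 : 0 < 1 - x := by linarith [hx.2]
      have h2 := hx.1
      rw [Real.norm_eq_abs, abs_mul, abs_of_nonneg (a := x ^ (a + k - 1) * _) (by positivity)]
    rw [setIntegral_congr_fun measurableSet_Ioo this, integral_const_mul,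
      setIntegral_beta hu (hδj j), abs_mul, mul_assoc, mul_assoc,
      ← abs_of_pos (ProbabilityTheory.beta_pos hu (hδj j)), ← abs_mul, hco, abs_mul,
      abs_of_pos (ProbabilityTheory.beta_pos hu hδ)]
  have hs : 0 < a + k + δ - (c - b) - (d - b) := by
    rw [hδ_def]
    have : 0 < b + k := by positivity
    linarith
  have hsum : Summable fun j => ∫ x in Set.Ioo (0 : ℝ) 1, ‖f j x‖ := by
    simp_rw [hnorm]
    exact (summable_abs_gaussTerm (by positivity) hs).mul_left _
  have hmain := (integral_tsum_of_summable_integral_norm hint hsum).symm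
  simp_rw [hval] at hmain
  rw [tsum_mul_left] at hmain
  rw [hypMoment, intervalIntegral.integral_of_le zero_le_one, integral_Ioc_eq_integral_Ioo,
    hypGaussSum, ← hmain]
  refine setIntegral_congr_fun measurableSet_Ioo fun x hx => ?_
  have h1 : 0 < 1 - x := by linarith [hx.2]
  have h2 := hx.1
  simp only [hypWeight, ordinaryHypergeometric_eq_tsum, smul_eq_mul]
  rw [← hδ_def, ← hK, ← mul_assoc, ← tsum_mul_left]
  refine tsum_congr fun j => ?_
  simp only [f, co]
  rw [show a + k - 1 = k + (a - 1) by ring, show δ + j - 1 = (δ - 1) + j by ring,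
    Real.rpow_add h2, Real.rpow_natCast, Real.rpow_add h1, Real.rpow_natCast]
  ring

theorem hypMoment_ne_zero (hc : ∀ k : ℕ, c ≠ -(k : ℝ)) (hd : ∀ k : ℕ, d ≠ -(k : ℝ)) (k : ℕ) :
    hypMoment a b c d k ≠ 0 := by
  have hu : 0 < a + k := by positivity
  rw [hypMoment_eq ha hb hδ]
  refine mul_ne_zero (mul_ne_zero (div_ne_zero (mul_ne_zero ?_ ?_) ?_) ?_) ?_
  · exact Real.Gamma_ne_zero hc
  · exact Real.Gamma_ne_zero hd
  · have := Real.Gamma_pos_of_pos ha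
    have := Real.Gamma_pos_of_pos hb
    have := Real.Gamma_pos_of_pos hδ
    positivity
  · exact (ProbabilityTheory.beta_pos hu hδ).ne'
  · refine hypGaussSum_ne_zero (by positivity) ?_ (fun m h => ?_) (fun m h => ?_)
    · have : 0 < b + k := by positivity
      linarith
    · exact hd (m + k) (by push_cast; linarith)
    · exact hc (m + k) (by push_cast; linarith)

/-- The Beta factor contributes (a+k)/(a+k+δ), and contiguity at lower parameter a+k+δ has gaps b+k,
d+k, c+k; the factor a+k+δ cancels. -/
theorem hypMoment_succ (k : ℕ) :
    (c + k) * (d + k) * hypMoment a b c d (k + 1) = (a + k) * (b + k) * hypMoment a b c d k := by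
  have hu : 0 < a + k := by positivity
  rw [hypMoment_eq ha hb hδ, hypMoment_eq ha hb hδ]
  have h1 := beta_succ_left hu hδ
  have h2 := hypGaussSum_contiguous (A := c - b) (B := d - b) (E := a + k + (c + d - a - b))
    (by positivity) (by have : 0 < b + k := by positivity
                        linarith)
  rw [Nat.cast_succ, show a + ((k : ℝ) + 1) = a + k + 1 by ring,
    show a + (k : ℝ) + 1 + (c + d - a - b) = a + k + (c + d - a - b) + 1 by ring]
  set K := Real.Gamma c * Real.Gamma d / (Real.Gamma a * Real.Gamma b * Real.Gamma (c + d - a - b))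
  set δ := c + d - a - b with hδ_def
  have h3 : a + k + δ ≠ 0 := by positivity
  rw [show a + k + δ - (c - b) - (d - b) = b + k by rw [hδ_def]; ring,
    show a + k + δ - (c - b) = d + k by rw [hδ_def]; ring,
    show a + k + δ - (d - b) = c + k by rw [hδ_def]; ring] at h2
  have h4 : (c + k) * (d + k) * hypGaussSum (c - b) (d - b) (a + k + δ + 1) =
    (a + k + δ) * (b + k) * hypGaussSum (c - b) (d - b) (a + k + δ) := by linarith
  calc _ = K * ProbabilityTheory.beta (a + k + 1) δ *
        ((c + k) * (d + k) * hypGaussSum (c - b) (d - b) (a + k + δ + 1)) := by ring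
    _ = K * (b + k) * hypGaussSum (c - b) (d - b) (a + k + δ) *
        (ProbabilityTheory.beta (a + k + 1) δ * (a + k + δ)) := by rw [h4]; ring
    _ = _ := by rw [h1]; ring

theorem hypMoment_eq_poch (hc : ∀ k : ℕ, c ≠ -(k : ℝ)) (hd : ∀ k : ℕ, d ≠ -(k : ℝ)) (k : ℕ) :
    hypMoment a b c d k =
      hypMoment a b c d 0 * (poch a k * poch b k / (poch c k * poch d k)) := by
  induction k with
  | zero => simp [poch]
  | succ k ih =>
    have h := hypMoment_succ ha hb hδ k
    have h1 := poch_ne_zero hc (k + 1)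
    have h2 := poch_ne_zero hd (k + 1)
    rw [poch_succ] at h1 h2
    rw [ih] at h
    simp only [poch_succ]
    have h3 := left_ne_zero_of_mul h1
    have h4 := left_ne_zero_of_mul h2
    have h5 := right_ne_zero_of_mul h1
    have h6 := right_ne_zero_of_mul h2
    field_simp at h ⊢
    linear_combination h

open MeasureTheory in
theorem intervalIntegrable_pow_mul_hypWeight (hc : ∀ k : ℕ, c ≠ -(k : ℝ))
    (hd : ∀ k : ℕ, d ≠ -(k : ℝ)) (k : ℕ) :
    IntervalIntegrable (fun x => x ^ k * hypWeight a b c d x) volume 0 1 :=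
  intervalIntegral.intervalIntegrable_of_integral_ne_zero (hypMoment_ne_zero ha hb hδ hc hd k)

/-- Integration of a polynomial times `xᵏ` against the weight. -/
theorem integral_eval_mul_hypWeight (hc : ∀ k : ℕ, c ≠ -(k : ℝ)) (hd : ∀ k : ℕ, d ≠ -(k : ℝ))
    (P : ℝ[X]) (k : ℕ) :
    ∫ x in (0 : ℝ)..1, P.eval x * x ^ k * hypWeight a b c d x =
      P.sum fun j p => p * hypMoment a b c d (j + k) := by
  simp only [Polynomial.sum, hypMoment, ← intervalIntegral.integral_const_mul]
  rw [← intervalIntegral.integral_finsetSum]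
  · congr 1
    ext x
    rw [Polynomial.eval_eq_sum, Polynomial.sum, Finset.sum_mul, Finset.sum_mul]
    refine Finset.sum_congr rfl fun j _ => ?_
    ring
  · intro j _
    exact (intervalIntegrable_pow_mul_hypWeight ha hb hδ hc hd _).const_mul _

end Moments

/-! ### Alternating binomial sums -/

theorem sum_alternating_choose_mul_eval_eq_zero {N : ℕ} {Q : ℝ[X]} (hQ : Q.natDegree < N) :
    ∑ j ∈ Finset.range (N + 1), (-1 : ℝ) ^ j * N.choose j * Q.eval (j : ℝ) = 0 := by
  have h := congrFun (Polynomial.fwdDiff_iter_eq_zero_of_degree_lt hQ) 0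
  rw [fwdDiff_iter_eq_sum_shift] at h
  have h2 : ∑ j ∈ Finset.range (N + 1), (-1 : ℝ) ^ j * N.choose j * Q.eval (j : ℝ) =
      (-1) ^ N * ∑ k ∈ Finset.range (N + 1),
        ((-1 : ℤ) ^ (N - k) * N.choose k) • Q.eval ((0 : ℝ) + k • 1) := by
    rw [Finset.mul_sum]
    refine Finset.sum_congr rfl fun j hj => ?_
    have hj' : j ≤ N := Nat.lt_succ_iff.1 (Finset.mem_range.1 hj)
    have h3 : (-1 : ℝ) ^ N * (-1) ^ (N - j) = (-1) ^ j := by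
      rw [← pow_add, show N + (N - j) = j + 2 * (N - j) by omega, pow_add, pow_mul]
      simp
    simp only [zero_add, nsmul_eq_mul, mul_one, zsmul_eq_mul, Int.cast_mul, Int.cast_pow,
      Int.cast_neg, Int.cast_one, Int.cast_natCast]
    rw [← h3]
    ring
  rw [h2, h]
  simp

/-- Pascal's rule: an (N+1)-st difference is the N-th difference of a first difference. -/
theorem sum_alternating_choose_succ (N : ℕ) (f : ℕ → ℝ) :
    ∑ j ∈ Finset.range (N + 2), (-1 : ℝ) ^ j * (N + 1).choose j * f j =
      ∑ j ∈ Finset.range (N + 1), (-1 : ℝ) ^ j * N.choose j * (f j - f (j + 1)) := by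
  have h1 : ∑ j ∈ Finset.range (N + 1), (-1 : ℝ) ^ j * N.choose j * f j =
      ∑ j ∈ Finset.range (N + 1), (-1 : ℝ) ^ (j + 1) * N.choose (j + 1) * f (j + 1) + f 0 := by
    rw [Finset.sum_range_succ', Finset.sum_range_succ (n := N)]
    simp
  rw [Finset.sum_range_succ']
  simp only [mul_sub, Finset.sum_sub_distrib, h1]
  simp only [Nat.choose_succ_succ, Nat.cast_add, mul_add, add_mul, Finset.sum_add_distrib, pow_succ]
  simp
  ring

theorem sum_alternating_choose_div {s : ℝ} (hs : ∀ k : ℕ, s ≠ -(k : ℝ)) (N : ℕ) :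
    ∑ j ∈ Finset.range (N + 1), (-1 : ℝ) ^ j * N.choose j * (1 / (s + j)) =
      N.factorial / poch s (N + 1) := by
  induction N generalizing s with
  | zero => simp [poch]
  | succ N ih =>
    have hs' : ∀ k : ℕ, s + 1 ≠ -(k : ℝ) := fun k h => hs (k + 1) (by push_cast; linarith)
    rw [sum_alternating_choose_succ]
    simp only [mul_sub, Finset.sum_sub_distrib]
    rw [ih hs]
    have : ∀ j : ℕ, s + ((j + 1 : ℕ) : ℝ) = s + 1 + j := fun j => by push_cast; ring
    simp only [this]
    rw [ih hs']
    have h0 : s ≠ 0 := by simpa using hs 0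
    have h1 := poch_ne_zero hs' (N + 1)
    have h2 := poch_ne_zero hs (N + 1)
    have h3 : poch s (N + 1 + 1) = s * poch (s + 1) (N + 1) := poch_succ' _ _
    have h4 := poch_shift s (N + 1)
    rw [h3, Nat.factorial_succ]
    push_cast at h4 ⊢
    field_simp
    linear_combination h4

/-- Dividing Q by X+s leaves a quotient of degree below N, which the N-th difference kills, and the
remainder Q(-s)/(s+j), summed by partial fractions. -/
theorem sum_alternating_choose_mul_eval_div {s : ℝ} (hs : ∀ k : ℕ, s ≠ -(k : ℝ)) {N : ℕ}
    {Q : ℝ[X]} (hQ : Q.natDegree ≤ N) :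
    ∑ j ∈ Finset.range (N + 1), (-1 : ℝ) ^ j * N.choose j * (Q.eval (j : ℝ) / (s + j)) =
      Q.eval (-s) * (N.factorial / poch s (N + 1)) := by
  obtain ⟨R, hR⟩ := X_sub_C_dvd_sub_C_eval (a := -s) (p := Q)
  have hev : ∀ j : ℕ, Q.eval (j : ℝ) / (s + j) = R.eval (j : ℝ) + Q.eval (-s) * (1 / (s + j)) := by
    intro j
    have h1 := congrArg (Polynomial.eval (j : ℝ)) hR
    simp only [eval_sub, eval_C, eval_mul, eval_X] at h1
    have h2 : s + j ≠ 0 := fun h => hs j (by linarith)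
    field_simp
    linear_combination h1
  have hR0 : ∑ j ∈ Finset.range (N + 1), (-1 : ℝ) ^ j * N.choose j * R.eval (j : ℝ) = 0 := by
    by_cases h0 : R = 0
    · simp [h0]
    · refine sum_alternating_choose_mul_eval_eq_zero ?_
      have h1 := congrArg natDegree hR
      rw [natDegree_sub_C, natDegree_mul (X_sub_C_ne_zero _) h0, natDegree_X_sub_C] at h1
      omega
  simp only [hev, mul_add, Finset.sum_add_distrib, hR0, zero_add]
  rw [← sum_alternating_choose_div hs, Finset.mul_sum]
  exact Finset.sum_congr rfl fun j _ => by ring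

/-! ### Orthogonality of the explicit polynomials against the moment ratios -/

theorem eval_pochPoly (x t : ℝ) (k : ℕ) :
    ((ascPochhammer ℝ k).comp (X + C x)).eval t = poch (t + x) k := by
  simp [eval_comp]

theorem natDegree_pochPoly (x : ℝ) (k : ℕ) :
    ((ascPochhammer ℝ k).comp (X + C x)).natDegree = k := by
  rw [natDegree_comp, ascPochhammer_natDegree, natDegree_X_add_C, mul_one]

theorem poch_ne_zero_of_lt {y : ℝ} {n : ℕ} (h : ∀ i < n, y ≠ -(i : ℝ)) : poch y n ≠ 0 := by
  rw [poch, Ne, ascPochhammer_eval_eq_zero_iff]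
  rintro ⟨k, hk, hk'⟩
  exact h k hk (by linarith)

theorem poch_add_div {x : ℝ} (hx : ∀ k : ℕ, x ≠ -(k : ℝ)) (j k : ℕ) :
    poch x (j + k) / poch x j = poch (j + x) k := by
  rw [poch_add, mul_div_cancel_left₀ _ (poch_ne_zero hx j), add_comm x]

/-- For l ≤ p the quotient is a polynomial in j of degree p-l, the cancellation behind
orthogonality. -/
theorem poch_shift_div {x : ℝ} (hx : ∀ k : ℕ, x ≠ -(k : ℝ)) {p l : ℕ} (h : l ≤ p) (j : ℕ) :
    poch (x + p) j / poch x (j + l) = poch (j + (x + l)) (p - l) / poch x p := by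
  rw [div_eq_div_iff (poch_ne_zero hx _) (poch_ne_zero hx _), mul_comm, ← poch_add, mul_comm,
    show (j : ℝ) + (x + l) = x + (j + l : ℕ) by push_cast; ring, ← poch_add]
  congr 1
  omega

/-- The first case beyond l ≤ p: one linear factor stays in the denominator. -/
theorem poch_shift_div_succ {x : ℝ} (hx : ∀ k : ℕ, x ≠ -(k : ℝ)) (p j : ℕ) :
    poch (x + p) j / poch x (j + (p + 1)) = 1 / poch x p * (1 / (x + p + j)) := by
  have h1 := poch_ne_zero hx (p + j)
  have h2 := poch_ne_zero hx p
  have h3 : x + p + j ≠ 0 := fun h => hx (p + j) (by push_cast; linarith)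
  rw [show j + (p + 1) = (p + j) + 1 by ring, poch_succ]
  rw [poch_add] at h1 ⊢
  have h4 := right_ne_zero_of_mul h1
  push_cast
  rw [← add_assoc]
  field_simp

section TypeII

variable (a b c d : ℝ)

/-- The coefficients of `₃F₂(-N, c + ⌊N/2⌋, d + ⌊(N-1)/2⌋; a, b; x)`. -/
noncomputable def typeIICoeff (N j : ℕ) : ℝ :=
  (-1) ^ j * N.choose j * (poch (c + (N / 2 : ℕ)) j * poch (d + ((N - 1) / 2 : ℕ)) j /
    (poch a j * poch b j))

/-- The moment ratios `(a)ⱼ₊ₖ (b)ⱼ₊ₗ / ((c)ⱼ₊ₗ (d)ⱼ₊ₖ)` with `k = ⌊i/2⌋`, `l = ⌈i/2⌉`. -/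
noncomputable def stepRatio (i j : ℕ) : ℝ :=
  poch a (j + i / 2) * poch b (j + (i + 1) / 2) /
    (poch c (j + (i + 1) / 2) * poch d (j + i / 2))

variable {a b c d}
variable (ha : ∀ k : ℕ, a ≠ -(k : ℝ)) (hb : ∀ k : ℕ, b ≠ -(k : ℝ))
  (hc : ∀ k : ℕ, c ≠ -(k : ℝ)) (hd : ∀ k : ℕ, d ≠ -(k : ℝ))

include ha hb in
theorem typeIICoeff_mul_stepRatio (N i j : ℕ) :
    typeIICoeff a b c d N j * stepRatio a b c d i j = (-1) ^ j * N.choose j *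
      (poch (j + a) (i / 2) * poch (j + b) ((i + 1) / 2) *
        (poch (c + (N / 2 : ℕ)) j / poch c (j + (i + 1) / 2)) *
        (poch (d + ((N - 1) / 2 : ℕ)) j / poch d (j + i / 2))) := by
  rw [← poch_add_div ha, ← poch_add_div hb, typeIICoeff, stepRatio]
  simp only [div_eq_mul_inv, mul_inv]
  ring

include ha hb hc hd

/-- The summand is (-1)ʲC(N,j) times a polynomial in j of degree at most k+l+(p-l)+(r-k) = p+r =
N-1. -/
theorem sum_typeIICoeff_mul_stepRatio_eq_zero {N i : ℕ} (hi : i < N) :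
    ∑ j ∈ Finset.range (N + 1), typeIICoeff a b c d N j * stepRatio a b c d i j = 0 := by
  simp only [typeIICoeff_mul_stepRatio ha hb]
  set p := N / 2 with hp
  set r := (N - 1) / 2 with hr
  set k := i / 2 with hk
  set l := (i + 1) / 2 with hl
  have hkr : k ≤ r := by omega
  have hlp : l ≤ p := by omega
  let Q : ℝ[X] := (ascPochhammer ℝ k).comp (X + C a) * (ascPochhammer ℝ l).comp (X + C b) *
    (ascPochhammer ℝ (p - l)).comp (X + C (c + l)) * (ascPochhammer ℝ (r - k)).comp (X + C (d + k))
  have hQ : Q.natDegree < N := by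
    have : Q.natDegree ≤ k + l + (p - l) + (r - k) :=
      natDegree_mul_le_of_le (natDegree_mul_le_of_le (natDegree_mul_le_of_le
        (natDegree_pochPoly _ _).le (natDegree_pochPoly _ _).le) (natDegree_pochPoly _ _).le)
        (natDegree_pochPoly _ _).le
    omega
  have h := sum_alternating_choose_mul_eval_eq_zero hQ
  have h2 := congrArg (· * (1 / (poch c p * poch d r))) h
  simp only [zero_mul, Finset.sum_mul] at h2
  rw [← h2]
  refine Finset.sum_congr rfl fun j _ => ?_
  rw [poch_shift_div hc hlp, poch_shift_div hd hkr]
  simp only [Q, eval_mul, eval_pochPoly]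
  simp only [div_eq_mul_inv, mul_inv]
  ring

/-- For i = N ≥ 1 exactly one quotient is not polynomial, leaving the denominator d+n+j when N =
2n+2 and c+n+j when N = 2n+1. The sum is then a nonzero multiple of (a-d-n)ₙ₊₁(b-d-n)ₙ₊₁,
respectively (a-c-n)ₙ(b-c-n)ₙ₊₁; the first factor in the odd case is shorter, whence c+1-a rather
than c-a. -/
theorem sum_typeIICoeff_mul_stepRatio_self_ne_zero
    (hda : ∀ k : ℕ, d - a ≠ -(k : ℝ)) (hdb : ∀ k : ℕ, d - b ≠ -(k : ℝ))
    (hca : ∀ k : ℕ, c + 1 - a ≠ -(k : ℝ)) (hcb : ∀ k : ℕ, c - b ≠ -(k : ℝ)) (N : ℕ) :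
    ∑ j ∈ Finset.range (N + 1), typeIICoeff a b c d N j * stepRatio a b c d N j ≠ 0 := by
  rcases Nat.even_or_odd' N with ⟨n, rfl | rfl⟩
  · rcases n with _ | n
    · simp [typeIICoeff, stepRatio, poch]
    simp only [typeIICoeff_mul_stepRatio ha hb]
    rw [show 2 * (n + 1) / 2 = n + 1 by omega, show (2 * (n + 1) + 1) / 2 = n + 1 by omega,
      show (2 * (n + 1) - 1) / 2 = n by omega]
    set N := 2 * (n + 1) with hN
    let Q : ℝ[X] := (ascPochhammer ℝ (n + 1)).comp (X + C a) *
      (ascPochhammer ℝ (n + 1)).comp (X + C b)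
    have hQ : Q.natDegree ≤ N := by
      have : Q.natDegree ≤ (n + 1) + (n + 1) :=
        natDegree_mul_le_of_le (natDegree_pochPoly _ _).le (natDegree_pochPoly _ _).le
      omega
    have hs : ∀ k : ℕ, d + n ≠ -(k : ℝ) := fun k h => hd (n + k) (by push_cast; linarith)
    have h := sum_alternating_choose_mul_eval_div hs hQ
    have h2 := congrArg (· * (1 / (poch c (n + 1) * poch d n))) h
    simp only [Finset.sum_mul] at h2
    have h3 : ∀ j ∈ Finset.range (N + 1), (-1) ^ j * (N.choose j : ℝ) *
        (poch (j + a) (n + 1) * poch (j + b) (n + 1) *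
          (poch (c + (n + 1 : ℕ)) j / poch c (j + (n + 1))) *
          (poch (d + n) j / poch d (j + (n + 1)))) =
        (-1) ^ j * (N.choose j : ℝ) * (Q.eval (j : ℝ) / (d + n + j)) *
          (1 / (poch c (n + 1) * poch d n)) := by
      intro j _
      rw [poch_shift_div hc le_rfl, poch_shift_div_succ hd]
      simp only [Q, eval_mul, eval_pochPoly, Nat.sub_self, poch_zero]
      simp only [div_eq_mul_inv, mul_inv]
      ring
    rw [Finset.sum_congr rfl h3, h2]
    simp only [Q, eval_mul, eval_pochPoly]
    refine mul_ne_zero (mul_ne_zero (mul_ne_zero ?_ ?_) ?_) ?_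
    · refine poch_ne_zero_of_lt fun i hi h => hda (n - i) ?_
      rw [Nat.cast_sub (by omega)]
      linarith
    · refine poch_ne_zero_of_lt fun i hi h => hdb (n - i) ?_
      rw [Nat.cast_sub (by omega)]
      linarith
    · exact div_ne_zero (by positivity) (poch_ne_zero hs _)
    · exact one_div_ne_zero (mul_ne_zero (poch_ne_zero hc _) (poch_ne_zero hd _))
  · simp only [typeIICoeff_mul_stepRatio ha hb]
    rw [show (2 * n + 1) / 2 = n by omega, show (2 * n + 1 + 1) / 2 = n + 1 by omega,
      show (2 * n + 1 - 1) / 2 = n by omega]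
    set N := 2 * n + 1 with hN
    let Q : ℝ[X] := (ascPochhammer ℝ n).comp (X + C a) *
      (ascPochhammer ℝ (n + 1)).comp (X + C b)
    have hQ : Q.natDegree ≤ N := by
      have : Q.natDegree ≤ n + (n + 1) :=
        natDegree_mul_le_of_le (natDegree_pochPoly _ _).le (natDegree_pochPoly _ _).le
      omega
    have hs : ∀ k : ℕ, c + n ≠ -(k : ℝ) := fun k h => hc (n + k) (by push_cast; linarith)
    have h := sum_alternating_choose_mul_eval_div hs hQ
    have h2 := congrArg (· * (1 / (poch c n * poch d n))) h
    simp only [Finset.sum_mul] at h2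
    have h3 : ∀ j ∈ Finset.range (N + 1), (-1) ^ j * (N.choose j : ℝ) *
        (poch (j + a) n * poch (j + b) (n + 1) *
          (poch (c + n) j / poch c (j + (n + 1))) * (poch (d + n) j / poch d (j + n))) =
        (-1) ^ j * (N.choose j : ℝ) * (Q.eval (j : ℝ) / (c + n + j)) *
          (1 / (poch c n * poch d n)) := by
      intro j _
      rw [poch_shift_div hd le_rfl, poch_shift_div_succ hc]
      simp only [Q, eval_mul, eval_pochPoly, Nat.sub_self, poch_zero]
      simp only [div_eq_mul_inv, mul_inv]
      ring
    rw [Finset.sum_congr rfl h3, h2]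
    simp only [Q, eval_mul, eval_pochPoly]
    refine mul_ne_zero (mul_ne_zero (mul_ne_zero ?_ ?_) ?_) ?_
    · refine poch_ne_zero_of_lt fun i hi h => hca (n - 1 - i) ?_
      rw [Nat.cast_sub (by omega), Nat.cast_sub (by omega)]
      push_cast
      linarith
    · refine poch_ne_zero_of_lt fun i hi h => hcb (n - i) ?_
      rw [Nat.cast_sub (by omega)]
      linarith
    · exact div_ne_zero (by positivity) (poch_ne_zero hs _)
    · exact one_div_ne_zero (mul_ne_zero (poch_ne_zero hc _) (poch_ne_zero hd _))

end TypeII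

/-! ### Sheppard's and Thomae's transformations -/

/-- The sum `∑ⱼ (-1)ʲ C(N, j) (C)ⱼ (D)ⱼ (a + j)_{N-j} (b + j)_{N-j}`, that is
`(a)_N (b)_N ₃F₂(-N, C, D; a, b; 1)` with the denominators cleared. -/
noncomputable def clearedSum (N : ℕ) (a b C D : ℝ) : ℝ :=
  ∑ j ∈ Finset.range (N + 1), (-1 : ℝ) ^ j * N.choose j *
    (poch C j * poch D j * (poch (a + j) (N - j) * poch (b + j) (N - j)))

/-- The image of `clearedSum` under Sheppard's transformation. -/
noncomputable def sheppardSum (N : ℕ) (a b C D : ℝ) : ℝ :=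
  ∑ i ∈ Finset.range (N + 1), (N.choose i : ℝ) *
    (poch (a - C) i * poch D i * (poch (b - D) (N - i) * poch (a + i) (N - i)))

/-- After one difference the identity (a+j)(b+j) - (C+j)(D+j) = (a-C)(D+j) + (b-D)(a+j) splits the
summand; D+j is absorbed into (D+1)ⱼ and a+j into (a+j)_{N-j}. `sheppardSum` obeys the same
recursion, so the two sums agree by induction on N with all parameters free. -/
theorem clearedSum_succ (N : ℕ) (a b C D : ℝ) :
    clearedSum (N + 1) a b C D = (a - C) * D * clearedSum N (a + 1) (b + 1) C (D + 1) +
      (b - D) * (a + N) * clearedSum N a (b + 1) C D := by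
  rw [clearedSum, sum_alternating_choose_succ, clearedSum, clearedSum, Finset.mul_sum,
    Finset.mul_sum, ← Finset.sum_add_distrib]
  refine Finset.sum_congr rfl fun j hj => ?_
  have hj' : j ≤ N := Nat.lt_succ_iff.1 (Finset.mem_range.1 hj)
  rw [show N + 1 - (j + 1) = N - j by omega, show N + 1 - j = N - j + 1 by omega]
  have e1 : a + ((j + 1 : ℕ) : ℝ) = a + j + 1 := by push_cast; ring
  have e2 : b + ((j + 1 : ℕ) : ℝ) = b + j + 1 := by push_cast; ring
  have e3 : a + 1 + (j : ℝ) = a + j + 1 := by ring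
  have e4 : b + 1 + (j : ℝ) = b + j + 1 := by ring
  have h1 : poch (a + j) (N - j) * (a + N) = (a + j) * poch (a + j + 1) (N - j) := by
    rw [← poch_succ', poch_succ, Nat.cast_sub hj']
    ring
  have h2 := poch_shift D j
  rw [e1, e2, e3, e4, poch_succ' (a + j), poch_succ' (b + j), poch_succ C, poch_succ D]
  linear_combination (-(-1) ^ j * (N.choose j : ℝ) * (b - D) * poch C j * poch D j *
    poch (b + j + 1) (N - j)) * h1 - ((-1) ^ j * (N.choose j : ℝ) * (a - C) * poch C j *
    poch (a + j + 1) (N - j) * poch (b + j + 1) (N - j)) * h2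

theorem sum_choose_succ_mul (N : ℕ) (f : ℕ → ℝ) :
    ∑ j ∈ Finset.range (N + 2), ((N + 1).choose j : ℝ) * f j =
      ∑ j ∈ Finset.range (N + 1), (N.choose j : ℝ) * (f j + f (j + 1)) := by
  have h := sum_alternating_choose_succ N fun j => (-1) ^ j * f j
  have e : ∀ j : ℕ, (-1 : ℝ) ^ j * (-1) ^ j = 1 := fun j => by
    rw [← mul_pow]; simp
  convert h using 2 with j _ j _
  · linear_combination (-((N + 1).choose j : ℝ) * f j) * e j
  · linear_combination (-(N.choose j : ℝ) * (f j + f (j + 1))) * e j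

theorem sheppardSum_succ (N : ℕ) (a b C D : ℝ) :
    sheppardSum (N + 1) a b C D = (a - C) * D * sheppardSum N (a + 1) (b + 1) C (D + 1) +
      (b - D) * (a + N) * sheppardSum N a (b + 1) C D := by
  rw [sheppardSum, sum_choose_succ_mul, sheppardSum, sheppardSum, Finset.mul_sum,
    Finset.mul_sum, ← Finset.sum_add_distrib]
  refine Finset.sum_congr rfl fun i hi => ?_
  have hi' : i ≤ N := Nat.lt_succ_iff.1 (Finset.mem_range.1 hi)
  rw [show N + 1 - (i + 1) = N - i by omega, show N + 1 - i = N - i + 1 by omega,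
    poch_succ' (b - D), poch_succ (a + i), poch_succ' (a - C), poch_succ' D, Nat.cast_sub hi',
    show a + ((i + 1 : ℕ) : ℝ) = a + 1 + i by push_cast; ring,
    show b + 1 - (D + 1) = b - D by ring, show a + 1 - C = a - C + 1 by ring,
    show b + 1 - D = b - D + 1 by ring]
  ring

theorem clearedSum_eq_sheppardSum (N : ℕ) (a b C D : ℝ) :
    clearedSum N a b C D = sheppardSum N a b C D := by
  induction N generalizing a b C D with
  | zero => simp [clearedSum, sheppardSum, poch]
  | succ N ih => rw [clearedSum_succ, sheppardSum_succ, ih, ih]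

/-- A terminating form of Thomae's transformation. -/
theorem clearedSum_thomae (N : ℕ) (a b C D : ℝ) :
    clearedSum N a b C D = clearedSum N a (a + b - C - D) (a - C) (a - D) := by
  have hsymm : clearedSum N a (a + b - C - D) (a - C) (a - D) =
      clearedSum N a (a + b - C - D) (a - D) (a - C) := by
    simp only [clearedSum]
    exact Finset.sum_congr rfl fun j _ => by ring
  -- With the last two arguments exchanged, the substitution merely swaps the factors (a-C)ᵢ and
  -- (D)ᵢ of Sheppard's sum and fixes b-D.
  rw [hsymm, clearedSum_eq_sheppardSum, clearedSum_eq_sheppardSum, sheppardSum, sheppardSum]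
  refine Finset.sum_congr rfl fun i _ => ?_
  rw [show a - (a - D) = D by ring, show a + b - C - D - (a - C) = b - D by ring]
  ring

/-! ### Rewriting the ₃F₂ at 1 as a sum without alternation -/

theorem poch_neg_natCast (N k : ℕ) :
    poch (-(N : ℝ)) k = (-1) ^ k * (N.choose k * k.factorial) := by
  induction k with
  | zero => simp [poch]
  | succ k ih =>
    have h := Nat.choose_succ_right_eq N k
    rw [poch_succ, ih, Nat.factorial_succ, pow_succ]
    rcases le_or_gt k N with hk | hk
    · have h' : (N.choose (k + 1) : ℝ) * (k + 1) = N.choose k * (N - k) := by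
        rw [← Nat.cast_sub hk]
        exact_mod_cast h
      push_cast
      linear_combination (-1) ^ k * (k.factorial : ℝ) * h'
    · simp [Nat.choose_eq_zero_of_lt hk, Nat.choose_eq_zero_of_lt (hk.trans (Nat.lt_succ_self k))]

theorem hyp3F2_neg_natCast (N : ℕ) (C D a b x : ℝ) :
    hyp3F2 (-(N : ℝ)) C D a b x = ∑ j ∈ Finset.range (N + 1),
      (-1) ^ j * N.choose j * (poch C j * poch D j / (poch a j * poch b j)) * x ^ j := by
  have h : ∀ k : ℕ, poch (-(N : ℝ)) k * poch C k * poch D k / (poch a k * poch b k) *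
      (x ^ k / (k.factorial : ℝ)) =
      (-1) ^ k * N.choose k * (poch C k * poch D k / (poch a k * poch b k)) * x ^ k := by
    intro k
    have : (k.factorial : ℝ) ≠ 0 := by positivity
    rw [poch_neg_natCast]
    simp only [div_eq_mul_inv]
    field_simp
  rw [hyp3F2]
  rw [tsum_congr h, tsum_eq_sum (s := Finset.range (N + 1))]
  intro k hk
  rw [Nat.choose_eq_zero_of_lt (by simpa using hk)]
  simp

theorem hyp3F2_eq_clearedSum {a b : ℝ} (ha : 0 < a) (hb : 0 < b) (N : ℕ) (C D : ℝ) :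
    poch a N * poch b N * hyp3F2 (-(N : ℝ)) C D a b 1 = clearedSum N a b C D := by
  rw [hyp3F2_neg_natCast, clearedSum, Finset.mul_sum]
  refine Finset.sum_congr rfl fun j hj => ?_
  have hj' : j ≤ N := Nat.lt_succ_iff.1 (Finset.mem_range.1 hj)
  have h1 : poch a N = poch a j * poch (a + j) (N - j) := by
    rw [← poch_add, Nat.add_sub_cancel' hj']
  have h2 : poch b N = poch b j * poch (b + j) (N - j) := by
    rw [← poch_add, Nat.add_sub_cancel' hj']
  have h3 := (poch_pos ha j).ne'
  have h4 := (poch_pos hb j).ne'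
  rw [h1, h2]
  field_simp
  simp

/-- The terms of the sum with eventually positive leading part which represents
`₃F₂(-N, a + α, a + β; a, b; 1)`. -/
noncomputable def thomaeTerm (a δ α β : ℝ) (N k : ℕ) : ℝ :=
  N.choose k * (poch (-α) k * poch (-β) k * poch δ (N - k) / poch a k)

theorem poch_neg_sub (δ : ℝ) (m : ℕ) : poch (-δ - m + 1) m = (-1) ^ m * poch δ m := by
  induction m with
  | zero => simp [poch]
  | succ m ih =>
    rw [poch_succ', show -δ - ((m + 1 : ℕ) : ℝ) + 1 + 1 = -δ - m + 1 by push_cast; ring, ih,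
      poch_succ]
    push_cast
    ring

/-- The condition on C+D makes the new lower parameter 1-δ-N. Reversing (1-δ-(N-j))_{N-j} produces
(-1)^{N-j}(δ)_{N-j}, and this sign absorbs the alternating (-1)ʲ. -/
theorem hyp3F2_eq_sum_thomaeTerm {a b δ C D : ℝ} (ha : 0 < a) (hb : 0 < b) {N : ℕ}
    (h : C + D = a + b + δ + N - 1) :
    poch b N * hyp3F2 (-(N : ℝ)) C D a b 1 =
      (-1) ^ N * ∑ k ∈ Finset.range (N + 1), thomaeTerm a δ (C - a) (D - a) N k := by
  refine mul_left_cancel₀ (poch_pos ha N).ne' ?_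
  rw [← mul_assoc, hyp3F2_eq_clearedSum ha hb, clearedSum_thomae, clearedSum, Finset.mul_sum,
    Finset.mul_sum]
  refine Finset.sum_congr rfl fun j hj => ?_
  have hj' : j ≤ N := Nat.lt_succ_iff.1 (Finset.mem_range.1 hj)
  have h1 : poch a N = poch a j * poch (a + j) (N - j) := by
    rw [← poch_add, Nat.add_sub_cancel' hj']
  have h2 : a + b - C - D + j = -δ - (N - j : ℕ) + 1 := by
    rw [Nat.cast_sub hj']; linarith
  have h3 := (poch_pos ha j).ne'
  have h4 : (-1 : ℝ) ^ j * (-1) ^ (N - j) = (-1) ^ N := by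
    rw [← pow_add, Nat.add_sub_cancel' hj']
  rw [h2, poch_neg_sub, h1, thomaeTerm, ← h4, neg_sub, neg_sub]
  field_simp

theorem thomaeTerm_comm (a δ α β : ℝ) (N k : ℕ) :
    thomaeTerm a δ α β N k = thomaeTerm a δ β α N k := by
  simp only [thomaeTerm]
  ring

theorem thomaeTerm_succ {a δ : ℝ} (ha : 0 < a) (α β : ℝ) {N k : ℕ} (hk : k < N) :
    thomaeTerm a δ α β N (k + 1) * ((k + 1) * (a + k) * (δ + (N - k) - 1)) =
      thomaeTerm a δ α β N k * ((N - k) * (α - k) * (β - k)) := by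
  have h : (N.choose (k + 1) : ℝ) * (k + 1) = N.choose k * (N - k) := by
    rw [← Nat.cast_sub hk.le]
    exact_mod_cast Nat.choose_succ_right_eq N k
  have h1 := (poch_pos ha k).ne'
  have h2 : a + k ≠ 0 := by positivity
  have h3 : poch δ (N - k) = poch δ (N - (k + 1)) * (δ + (N - k) - 1) := by
    rw [show N - k = N - (k + 1) + 1 by omega, poch_succ, Nat.cast_sub (by omega)]
    push_cast
    ring
  simp only [thomaeTerm, poch_succ, h3]
  field_simp
  linear_combination (poch (-α) k * poch (-β) k * poch δ (N - (k + 1)) * (δ + (N - k) - 1) *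
    (-α + k) * (-β + k)) * h

/-- The exact factor gained when N and α both increase by 1; for k ≈ N/4 and α ≈ N/2 it is about 2N.
-/
theorem thomaeTerm_param_succ (a δ α β : ℝ) {N k : ℕ} (hk : k ≤ N) :
    thomaeTerm a δ (α + 1) β (N + 1) k * ((N + 1 - k) * (α + 1 - k)) =
      thomaeTerm a δ α β N k * ((N + 1) * (δ + (N - k)) * (α + 1)) := by
  have h : (N.choose k : ℝ) * (N + 1) = (N + 1).choose k * (N + 1 - k) := by
    have := Nat.choose_mul_succ_eq N k
    have h' : ((N + 1 - k : ℕ) : ℝ) = N + 1 - k := by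
      rw [Nat.cast_sub (by omega)]
      push_cast
      ring
    rw [← h']
    exact_mod_cast this
  have h2 := poch_shift (-(α + 1)) k
  rw [show -(α + 1) + 1 = -α by ring] at h2
  have h3 : poch δ (N + 1 - k) = poch δ (N - k) * (δ + (N - k)) := by
    rw [show N + 1 - k = N - k + 1 by omega, poch_succ, Nat.cast_sub hk]
  simp only [thomaeTerm, h3, div_eq_mul_inv]
  linear_combination (-poch (-(α + 1)) k * poch (-β) k * poch δ (N - k) * (δ + (N - k)) *
    (poch a k)⁻¹ * (α + 1 - k)) * h + ((N.choose k : ℝ) * (N + 1) * poch (-β) k * poch δ (N - k) *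
    (δ + (N - k)) * (poch a k)⁻¹) * h2

/-! ### Growth before N/4, decay after N/4 -/

section Concentration

variable {a δ K : ℝ} (ha : 0 < a) (hδ : 0 < δ) {N : ℕ} {α β : ℝ}
  (hα : |α - N / 2| ≤ K) (hβ : |β - N / 2| ≤ K)

include ha hδ hα hβ

/-- All factors of the term ratio are positive while k stays below α and β, and the term at k = 0 is
(δ)_N. -/
theorem thomaeTerm_pos {k : ℕ} (hk : (k : ℝ) < N / 2 - K) : 0 < thomaeTerm a δ α β N k := by
  rw [abs_le] at hα hβ
  have hK : 0 ≤ K := by linarith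
  induction k with
  | zero => simpa [thomaeTerm, poch] using poch_pos hδ N
  | succ k ih =>
    push_cast at hk
    have hN : (0 : ℝ) ≤ N := Nat.cast_nonneg N
    have hk0 : (0 : ℝ) ≤ k := Nat.cast_nonneg k
    have hkN : k + 1 ≤ N := by
      have : ((k + 1 : ℕ) : ℝ) ≤ N := by push_cast; linarith
      exact_mod_cast this
    have hkN' : (k : ℝ) + 1 ≤ N := by exact_mod_cast hkN
    have h := thomaeTerm_succ (δ := δ) ha α β (Nat.lt_of_succ_le hkN)
    have h1 : 0 < thomaeTerm a δ α β N k * ((N - k) * (α - k) * (β - k)) := by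
      refine mul_pos (ih (by linarith)) (mul_pos (mul_pos ?_ ?_) ?_) <;> linarith
    rw [← h] at h1
    refine pos_of_mul_pos_left h1 ?_
    refine mul_nonneg (by positivity) ?_
    linarith

/-- Here (α-k)(β-k) ≥ (N/4 + εN/2)² ≥ (1+4ε)(N/4)², while (k+1)(a+k) ≤ (N/4)²; the surplus 3ε pays
for δ in the remaining factor. -/
theorem thomaeTerm_growth {ε : ℝ} (hε : 0 < ε) (hε' : ε ≤ 1 / 8) (hNa : a + 1 ≤ ε * N)
    (hNK : 2 * K ≤ ε * N) (hNδ : δ ≤ ε * N) {k : ℕ} (hk : (k : ℝ) ≤ (1 / 4 - ε) * N) :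
    (1 + ε) * thomaeTerm a δ α β N k ≤ thomaeTerm a δ α β N (k + 1) := by
  have hk0 : (0 : ℝ) ≤ k := Nat.cast_nonneg k
  have hNpos : (0 : ℝ) < N := by
    by_contra h
    have : (N : ℝ) = 0 := le_antisymm (not_lt.1 h) (Nat.cast_nonneg N)
    rw [this] at hNa
    linarith
  have hεN : 0 < ε * N := by positivity
  have hεN' : ε * N ≤ N / 8 := by nlinarith
  have hpos : 0 < thomaeTerm a δ α β N k := thomaeTerm_pos ha hδ hα hβ (by nlinarith)
  rw [abs_le] at hα hβ
  have hkN : k < N := by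
    have : (k : ℝ) < N := by nlinarith
    exact_mod_cast this
  have h := thomaeTerm_succ (δ := δ) ha α β hkN
  have hkε : (k : ℝ) ≤ N / 4 - ε * N := by linarith
  have hm : 3 / 4 * (N : ℝ) ≤ N - k := by linarith
  have hN1 : 1 ≤ ε * N := by linarith
  have hm1 : 0 < δ + (N - k) - 1 := by linarith
  have hD : 0 < ((k : ℝ) + 1) * (a + k) * (δ + (N - k) - 1) := mul_pos (by positivity) hm1
  have h1 : ((k : ℝ) + 1) * (a + k) ≤ (N / 4) * (N / 4) :=
    mul_le_mul (by linarith) (by linarith) (by positivity) (by positivity)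
  have h2 : (N / 4 + ε * N / 2) * (N / 4 + ε * N / 2) ≤ (α - k) * (β - k) :=
    mul_le_mul (by linarith) (by linarith) (by positivity) (by linarith)
  have h3 : (1 + 4 * ε) * ((N / 4) * (N / 4)) ≤ (α - k) * (β - k) := by
    refine le_trans ?_ h2
    linarith [mul_self_nonneg (ε * N)]
  have h4 : (1 + ε) * (δ + (N - k) - 1) ≤ (N - k) * (1 + 4 * ε) := by
    have h5 : ε * δ ≤ 1 * (ε * N) := mul_le_mul (by linarith) hNδ hδ.le zero_le_one
    have h6 := mul_le_mul_of_nonneg_left hm hε.le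
    linarith
  have h5 : (1 + ε) * (((k : ℝ) + 1) * (a + k) * (δ + (N - k) - 1)) ≤
      (N - k) * (α - k) * (β - k) := by
    calc _ = (((k : ℝ) + 1) * (a + k)) * ((1 + ε) * (δ + (N - k) - 1)) := by ring
      _ ≤ ((N / 4) * (N / 4)) * ((N - k) * (1 + 4 * ε)) := by
        refine mul_le_mul h1 h4 ?_ (by positivity)
        exact mul_nonneg (by positivity) hm1.le
      _ = (N - k) * ((1 + 4 * ε) * ((N / 4) * (N / 4))) := by ring
      _ ≤ (N - k) * ((α - k) * (β - k)) := by
        refine mul_le_mul_of_nonneg_left h3 ?_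
        linarith
      _ = _ := by ring
  refine le_of_mul_le_mul_right ?_ hD
  rw [h]
  calc _ = thomaeTerm a δ α β N k *
        ((1 + ε) * (((k : ℝ) + 1) * (a + k) * (δ + (N - k) - 1))) := by ring
    _ ≤ _ := mul_le_mul_of_nonneg_left h5 hpos.le

omit hδ in
-- Beyond N/4 both |α-k| and |β-k| are at most (1-3ε)k, also after the terms may change sign. The
-- factor q stays free because (N-k)/(δ+N-k-1) can be large when k is near N and δ is small.
theorem abs_thomaeTerm_succ_le {ε : ℝ} (hε : 0 < ε) (hε' : ε ≤ 1 / 8) (hNK : 4 * K ≤ ε * N)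
    {k : ℕ} (hk : (1 / 4 + ε) * N ≤ k) (hkN : k < N) {q : ℝ}
    (hD : 0 < δ + (N - k) - 1) (hq : (1 - 3 * ε) * ((N : ℝ) - k) ≤ q * (δ + (N - k) - 1)) :
    |thomaeTerm a δ α β N (k + 1)| ≤ q * |thomaeTerm a δ α β N k| := by
  have hk0 : (0 : ℝ) ≤ k := Nat.cast_nonneg k
  have hN0 : (0 : ℝ) ≤ N := Nat.cast_nonneg N
  have hkN' : (k : ℝ) < N := by exact_mod_cast hkN
  have hkpos : (0 : ℝ) < k := by
    have : (0 : ℝ) < N := by linarith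
    nlinarith
  have hNk : (N : ℝ) ≤ 4 * k := by
    have := mul_nonneg hε.le hN0
    linarith
  have hKk : K ≤ ε * k := by
    have := mul_le_mul_of_nonneg_left hNk hε.le
    linarith
  have hmid : |(N : ℝ) / 2 - k| ≤ (1 - 4 * ε) * k := by
    rw [abs_le]
    constructor
    · nlinarith
    · nlinarith [mul_le_mul_of_nonneg_left hk (show (0 : ℝ) ≤ 2 - 4 * ε by linarith),
        mul_nonneg hε.le hN0]
  have habs : ∀ x : ℝ, |x - N / 2| ≤ K → |x - k| ≤ (1 - 3 * ε) * k := by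
    intro x hx
    have := abs_add_le (x - N / 2) (N / 2 - k)
    rw [show x - N / 2 + (N / 2 - k) = x - k by ring] at this
    nlinarith
  have h1 : |α - k| * |β - k| ≤ (1 - 3 * ε) * ((k + 1) * (a + k)) := by
    calc _ ≤ ((1 - 3 * ε) * k) * ((1 - 3 * ε) * k) :=
          mul_le_mul (habs α hα) (habs β hβ) (abs_nonneg _) (by nlinarith)
      _ = (1 - 3 * ε) * ((1 - 3 * ε) * (k * k)) := by ring
      _ ≤ (1 - 3 * ε) * (1 * ((k + 1) * (a + k))) := by
        refine mul_le_mul_of_nonneg_left ?_ (by linarith)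
        refine mul_le_mul (by linarith) ?_ (by positivity) zero_le_one
        exact mul_le_mul (by linarith) (by linarith) hk0 (by positivity)
      _ = _ := by ring
  have h := congrArg abs (thomaeTerm_succ (δ := δ) ha α β hkN)
  have hE : 0 < ((k : ℝ) + 1) * (a + k) * (δ + (N - k) - 1) := mul_pos (by positivity) hD
  rw [abs_mul, abs_of_pos hE, abs_mul, abs_mul, abs_mul,
    abs_of_pos (show (0 : ℝ) < N - k by linarith)] at h
  refine le_of_mul_le_mul_right ?_ hE
  rw [h]
  have h2 : ((N : ℝ) - k) * |α - k| * |β - k| ≤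
      q * (((k : ℝ) + 1) * (a + k) * (δ + (N - k) - 1)) := by
    calc _ = ((N : ℝ) - k) * (|α - k| * |β - k|) := by ring
      _ ≤ ((N : ℝ) - k) * ((1 - 3 * ε) * ((k + 1) * (a + k))) :=
        mul_le_mul_of_nonneg_left h1 (by linarith)
      _ = ((1 - 3 * ε) * ((N : ℝ) - k)) * ((k + 1) * (a + k)) := by ring
      _ ≤ (q * (δ + (N - k) - 1)) * ((k + 1) * (a + k)) :=
        mul_le_mul_of_nonneg_right hq (by positivity)
      _ = _ := by ring
  calc _ ≤ |thomaeTerm a δ α β N k| * (q * (((k : ℝ) + 1) * (a + k) * (δ + (N - k) - 1))) :=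
        mul_le_mul_of_nonneg_left h2 (abs_nonneg _)
    _ = _ := by ring

end Concentration

theorem mul_pow_le_of_growth {v : ℕ → ℝ} {r : ℝ} {m : ℕ} (hr : 0 ≤ r)
    (h : ∀ k < m, r * v k ≤ v (k + 1)) {k : ℕ} (hk : k ≤ m) : r ^ (m - k) * v k ≤ v m := by
  induction m, hk using Nat.le_induction with
  | base => simp
  | succ m hkm ih =>
    rw [show m + 1 - k = m - k + 1 by omega, pow_succ']
    have h1 := ih fun i hi => h i (by omega)
    have h2 := h m (by omega)
    calc _ = r * (r ^ (m - k) * v k) := by ring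
      _ ≤ r * v m := mul_le_mul_of_nonneg_left h1 hr
      _ ≤ _ := h2

/-- Each of the at most J final steps may violate the rate q, at a cost of M/q. -/
theorem le_pow_mul_of_decay {v : ℕ → ℝ} {q M : ℝ} {m N J : ℕ} (hv : ∀ k, 0 ≤ v k) (hq : 0 < q)
    (hM : q ≤ M) (h1 : ∀ k, m ≤ k → k + J < N → v (k + 1) ≤ q * v k)
    (h2 : ∀ k, m ≤ k → k < N → v (k + 1) ≤ M * v k) {k : ℕ} (hmk : m ≤ k) (hk : k ≤ N) :
    v k ≤ (M / q) ^ J * q ^ (k - m) * v m := by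
  have hMq : 1 ≤ M / q := (one_le_div hq).2 hM
  have key : v k ≤ (M / q) ^ (k + J - N) * q ^ (k - m) * v m := by
    induction k, hmk using Nat.le_induction with
    | base =>
      rw [Nat.sub_self, pow_zero, mul_one]
      exact le_mul_of_one_le_left (hv m) (one_le_pow₀ hMq)
    | succ k hmk ih =>
      have ih' := ih (by omega)
      rcases lt_or_ge (k + J) N with hlt | hge
      · have := h1 k hmk hlt
        rw [show k + 1 + J - N = 0 by omega, show k + 1 - m = k - m + 1 by omega]
        rw [show k + J - N = 0 by omega] at ih'
        calc _ ≤ q * v k := this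
          _ ≤ q * ((M / q) ^ 0 * q ^ (k - m) * v m) := mul_le_mul_of_nonneg_left ih' hq.le
          _ = _ := by ring
      · have := h2 k hmk (by omega)
        rw [show k + 1 + J - N = (k + J - N) + 1 by omega, show k + 1 - m = k - m + 1 by omega]
        calc _ ≤ M * v k := this
          _ ≤ M * ((M / q) ^ (k + J - N) * q ^ (k - m) * v m) :=
            mul_le_mul_of_nonneg_left ih' (hq.le.trans hM)
          _ = (M / q * q) * ((M / q) ^ (k + J - N) * q ^ (k - m) * v m) := by
            rw [div_mul_cancel₀ _ hq.ne']
          _ = _ := by ring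
  refine key.trans ?_
  have : (M / q) ^ (k + J - N) ≤ (M / q) ^ J := pow_le_pow_right₀ hMq (by omega)
  have h3 : 0 ≤ q ^ (k - m) * v m := mul_nonneg (by positivity) (hv m)
  calc _ = (M / q) ^ (k + J - N) * (q ^ (k - m) * v m) := by ring
    _ ≤ (M / q) ^ J * (q ^ (k - m) * v m) := mul_le_mul_of_nonneg_right this h3
    _ = _ := by ring

theorem eventually_succ_mul_pow_floor_le {x e C : ℝ} (hx : 0 ≤ x) (hx1 : x < 1) (he : 0 < e)
    (hC : 0 < C) : ∀ᶠ N : ℕ in atTop, ((N : ℝ) + 1) * x ^ ⌊e * (N : ℝ)⌋₊ ≤ C := by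
  have hL : Tendsto (fun N : ℕ => ⌊e * (N : ℝ)⌋₊) atTop atTop :=
    tendsto_nat_floor_atTop.comp (tendsto_natCast_atTop_atTop.const_mul_atTop he)
  have h1 : Tendsto (fun n : ℕ => (1 / e + 1) * ((n : ℝ) * x ^ n + x ^ n)) atTop (𝓝 0) := by
    have := ((tendsto_self_mul_const_pow_of_lt_one hx hx1).add
      (tendsto_pow_atTop_nhds_zero_of_lt_one hx hx1)).const_mul (1 / e + 1)
    simpa using this
  filter_upwards [(h1.comp hL).eventually_le_const hC] with N hN
  refine le_trans ?_ hN
  simp only [Function.comp]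
  set n := ⌊e * (N : ℝ)⌋₊ with hn
  have h2 : e * (N : ℝ) < n + 1 := Nat.lt_floor_add_one _
  have h3 : (N : ℝ) ≤ 1 / e * (n + 1) := by
    rw [one_div, ← div_eq_inv_mul, le_div_iff₀ he]
    linarith
  have h4 : (0 : ℝ) ≤ n := Nat.cast_nonneg n
  calc _ ≤ ((1 / e + 1) * ((n : ℝ) + 1)) * x ^ n :=
        mul_le_mul_of_nonneg_right (by linarith) (by positivity)
    _ = _ := by ring

theorem eventually_le_mul_natCast (C : ℝ) {ε : ℝ} (hε : 0 < ε) : ∀ᶠ N : ℕ in atTop, C ≤ ε * N :=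
  (tendsto_natCast_atTop_atTop.const_mul_atTop hε).eventually_ge_atTop C

/-- The terms `thomaeTerm a δ α β N k` with `α, β = N / 2 + O(1)` concentrate at `k ≈ N / 4`. -/
theorem thomaeTerm_dominated {a δ : ℝ} (ha : 0 < a) (hδ : 0 < δ) (K : ℝ) {ε η : ℝ} (hε : 0 < ε)
    (hε' : ε ≤ 1 / 16) (hη : 0 < η) :
    ∀ᶠ N : ℕ in atTop, ∀ α β : ℝ, |α - N / 2| ≤ K → |β - N / 2| ≤ K → ∀ k ≤ N,
      ε * N < |(k : ℝ) - N / 4| → ∃ m ≤ N, |(m : ℝ) - N / 4| ≤ ε * N ∧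
        ((N : ℝ) + 1) * |thomaeTerm a δ α β N k| ≤ η * thomaeTerm a δ α β N m := by
  -- Half of the margin secures a uniform geometric rate; the other half supplies about eN steps at
  -- that rate.
  obtain ⟨e, rfl⟩ : ∃ e, ε = 2 * e := ⟨ε / 2, by ring⟩
  have he : 0 < e := by linarith
  -- The rate q needs e(N-k) ≥ 1, that is N-k ≥ 1/e, hence J. In the last steps M = 1+1/δ suffices,
  -- since M(δ+m-1) ≥ m for every m ≥ 1.
  set q := 1 - 2 * e with hq
  set M := 1 + 1 / δ with hM
  set J := ⌈1 / e⌉₊ with hJ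
  have hq0 : 0 < q := by linarith
  have hMpos : 0 < M / q := by positivity
  filter_upwards [eventually_le_mul_natCast (a + 1) he, eventually_le_mul_natCast (4 * K) he,
    eventually_le_mul_natCast δ he, eventually_le_mul_natCast 1 he,
    eventually_succ_mul_pow_floor_le (x := (1 + e)⁻¹) (by positivity)
      (inv_lt_one_of_one_lt₀ (by linarith)) he hη,
    eventually_succ_mul_pow_floor_le (x := q) hq0.le (by linarith) he
      (show 0 < η / (M / q) ^ J by positivity)] with N hNa hNK hNδ hN1 hL hR α β hα hβ k hk hout
  have hK : 0 ≤ K := (abs_nonneg _).trans hα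
  have hN0 : (0 : ℝ) ≤ N := Nat.cast_nonneg N
  have heN : e * N ≤ 1 / 32 * N := mul_le_mul_of_nonneg_right (by linarith) hN0
  have hfl : (⌊e * (N : ℝ)⌋₊ : ℝ) ≤ e * N := Nat.floor_le (by positivity)
  rcases lt_abs.1 hout with hr | hl
  · set m := ⌈(1 / 4 + e) * (N : ℝ)⌉₊ with hm
    have hm1 : (1 / 4 + e) * (N : ℝ) ≤ m := Nat.le_ceil _
    have hm2 : (m : ℝ) < (1 / 4 + e) * N + 1 := Nat.ceil_lt_add_one (by positivity)
    have hmk : m + ⌊e * (N : ℝ)⌋₊ ≤ k := by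
      have h1 : ⌊e * (N : ℝ)⌋₊ ≤ k := by
        have : (⌊e * (N : ℝ)⌋₊ : ℝ) ≤ k := by linarith
        exact_mod_cast this
      have h2 : m ≤ k - ⌊e * (N : ℝ)⌋₊ := by
        refine Nat.ceil_le.2 ?_
        rw [Nat.cast_sub h1]
        linarith
      omega
    have hmpos : 0 < thomaeTerm a δ α β N m := thomaeTerm_pos ha hδ hα hβ (by linarith)
    refine ⟨m, by omega, ?_, ?_⟩
    · rw [abs_le]
      constructor <;> linarith
    have hstep : ∀ i : ℕ, m ≤ i → i < N → (1 / 4 + e) * (N : ℝ) ≤ i ∧ (1 : ℝ) ≤ N - i := by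
      intro i hi hiN
      have h1 : (m : ℝ) ≤ i := by exact_mod_cast hi
      have h2 : ((i + 1 : ℕ) : ℝ) ≤ N := by exact_mod_cast hiN
      push_cast at h2
      exact ⟨hm1.trans h1, by linarith⟩
    have hdec := le_pow_mul_of_decay (v := fun i => |thomaeTerm a δ α β N i|) (q := q) (M := M)
      (m := m) (N := N) (J := J) (fun _ => abs_nonneg _) hq0
      (by have : 0 < 1 / δ := by positivity
          linarith) ?_ ?_ (show m ≤ k by omega) hk
    · rw [abs_of_pos hmpos] at hdec
      have h1 : q ^ (k - m) ≤ q ^ ⌊e * (N : ℝ)⌋₊ :=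
        pow_le_pow_of_le_one hq0.le (by linarith) (by omega)
      rw [le_div_iff₀ (by positivity)] at hR
      calc _ ≤ ((N : ℝ) + 1) * ((M / q) ^ J * q ^ ⌊e * (N : ℝ)⌋₊ * thomaeTerm a δ α β N m) := by
            refine mul_le_mul_of_nonneg_left (hdec.trans ?_) (by positivity)
            refine mul_le_mul_of_nonneg_right ?_ hmpos.le
            exact mul_le_mul_of_nonneg_left h1 (by positivity)
        _ = (((N : ℝ) + 1) * q ^ ⌊e * (N : ℝ)⌋₊ * (M / q) ^ J) * thomaeTerm a δ α β N m := by ring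
        _ ≤ _ := mul_le_mul_of_nonneg_right hR hmpos.le
    · intro i hi hiJ
      obtain ⟨h1, h2⟩ := hstep i hi (by omega)
      refine abs_thomaeTerm_succ_le ha hα hβ he (by linarith) hNK h1 (by omega) (by linarith) ?_
      have h3 : (1 : ℝ) / e ≤ N - i := by
        have h4 : 1 / e ≤ (J : ℝ) := Nat.le_ceil _
        have h5 : ((i + J : ℕ) : ℝ) ≤ N := by exact_mod_cast hiJ.le
        push_cast at h5
        linarith
      rw [div_le_iff₀ he] at h3
      have h6 : 0 ≤ q * δ := by positivity
      have h7 : q * (δ + (N - i) - 1) = q * δ + ((N : ℝ) - i) - 2 * ((N - i) * e) - q := by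
        rw [hq]; ring
      rw [h7]
      linarith
    · intro i hi hiN
      obtain ⟨h1, h2⟩ := hstep i hi hiN
      refine abs_thomaeTerm_succ_le ha hα hβ he (by linarith) hNK h1 hiN (by linarith) ?_
      have h3 : M * (δ + (N - i) - 1) = (N - i) + δ + (N - i - 1) / δ := by
        rw [hM]; field_simp; ring
      have h4 : 0 ≤ ((N : ℝ) - i - 1) / δ := div_nonneg (by linarith) hδ.le
      have h5 : 0 ≤ e * ((N : ℝ) - i) := mul_nonneg he.le (by linarith)
      rw [h3]
      linarith
  · set m := ⌊(1 / 4 - e) * (N : ℝ)⌋₊ with hm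
    have hpos : 0 ≤ (1 / 4 - e) * (N : ℝ) := mul_nonneg (by linarith) hN0
    have hm1 : (m : ℝ) ≤ (1 / 4 - e) * N := Nat.floor_le hpos
    have hm2 : (1 / 4 - e) * (N : ℝ) < m + 1 := Nat.lt_floor_add_one _
    have hmk : k + ⌊e * (N : ℝ)⌋₊ ≤ m := by
      refine Nat.le_floor ?_
      push_cast
      linarith
    have hmN : m ≤ N := by
      have : (m : ℝ) ≤ N := by linarith
      exact_mod_cast this
    have hmpos : 0 < thomaeTerm a δ α β N m := thomaeTerm_pos ha hδ hα hβ (by linarith)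
    have hkpos : 0 < thomaeTerm a δ α β N k := thomaeTerm_pos ha hδ hα hβ (by linarith)
    refine ⟨m, hmN, ?_, ?_⟩
    · rw [abs_le]
      constructor <;> linarith
    have hgr := mul_pow_le_of_growth (v := thomaeTerm a δ α β N) (r := 1 + e) (m := m)
      (by linarith) (fun i hi => thomaeTerm_growth ha hδ hα hβ he (by linarith) hNa (by linarith)
        hNδ (by have : (i : ℝ) ≤ m := by exact_mod_cast hi.le
                linarith)) (show k ≤ m by omega)
    have h1 : (1 + e) ^ ⌊e * (N : ℝ)⌋₊ * thomaeTerm a δ α β N k ≤ thomaeTerm a δ α β N m :=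
      le_trans (mul_le_mul_of_nonneg_right
        (pow_le_pow_right₀ (by linarith) (by omega)) hkpos.le) hgr
    rw [inv_pow, ← div_eq_mul_inv, div_le_iff₀ (by positivity)] at hL
    rw [abs_of_pos hkpos]
    calc _ ≤ (η * (1 + e) ^ ⌊e * (N : ℝ)⌋₊) * thomaeTerm a δ α β N k :=
          mul_le_mul_of_nonneg_right hL hkpos.le
      _ = η * ((1 + e) ^ ⌊e * (N : ℝ)⌋₊ * thomaeTerm a δ α β N k) := by ring
      _ ≤ _ := mul_le_mul_of_nonneg_left h1 hη.le

/-- At most N+1 indices lie outside Z, and each contributes at most η/(N+1) times the sum over Z. -/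
theorem abs_sum_sub_le_of_dominated {N : ℕ} {t : ℕ → ℝ} {η : ℝ} (hη : 0 ≤ η) {Z : Finset ℕ}
    (hZ : Z ⊆ Finset.range (N + 1)) (hpos : ∀ k ∈ Z, 0 ≤ t k)
    (h : ∀ k ≤ N, k ∉ Z → ∃ m ∈ Z, ((N : ℝ) + 1) * |t k| ≤ η * t m) :
    |∑ k ∈ Finset.range (N + 1), t k - ∑ k ∈ Z, t k| ≤ η * ∑ k ∈ Z, t k := by
  rw [← Finset.sum_sdiff hZ, add_sub_cancel_right]
  have hN : (0 : ℝ) < (N : ℝ) + 1 := by positivity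
  have hS : 0 ≤ ∑ k ∈ Z, t k := Finset.sum_nonneg hpos
  have h1 : ∀ k ∈ Finset.range (N + 1) \ Z, |t k| ≤ η * (∑ k ∈ Z, t k) / (N + 1) := by
    intro k hk
    rw [Finset.mem_sdiff, Finset.mem_range] at hk
    obtain ⟨m, hm, hkm⟩ := h k (by omega) hk.2
    rw [le_div_iff₀ hN, mul_comm]
    exact hkm.trans (mul_le_mul_of_nonneg_left (Finset.single_le_sum hpos hm) hη)
  calc _ ≤ ∑ k ∈ Finset.range (N + 1) \ Z, |t k| := Finset.abs_sum_le_sum_abs _ _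
    _ ≤ (Finset.range (N + 1) \ Z).card • (η * (∑ k ∈ Z, t k) / (N + 1)) :=
      Finset.sum_le_card_nsmul _ _ _ h1
    _ ≤ ((N : ℝ) + 1) * (η * (∑ k ∈ Z, t k) / (N + 1)) := by
      rw [nsmul_eq_mul]
      refine mul_le_mul_of_nonneg_right ?_ (by positivity)
      have := Finset.card_le_card (Finset.sdiff_subset (s := Finset.range (N + 1)) (t := Z))
      rw [Finset.card_range] at this
      exact_mod_cast this
    _ = _ := mul_div_cancel₀ _ hN.ne'

/-! ### The ratio of consecutive sums -/

theorem thomaeTerm_param_succ_bounds {a δ K ε : ℝ} (ha : 0 < a) (hδ : 0 < δ) (hε : 0 < ε)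
    (hε' : ε ≤ 1 / 16) {N : ℕ} {α β : ℝ} (hα : |α - N / 2| ≤ K) (hβ : |β - N / 2| ≤ K)
    (hNK : 4 * (K + 1) ≤ ε * N) (hNδ : 2 * δ ≤ ε * N) {k : ℕ}
    (hk : |(k : ℝ) - N / 4| ≤ ε * N) :
    2 * (1 - ε) ^ 2 / (1 + 8 * ε) * N * thomaeTerm a δ α β N k ≤
        thomaeTerm a δ (α + 1) β (N + 1) k ∧
      thomaeTerm a δ (α + 1) β (N + 1) k ≤
        2 * (1 + ε) ^ 3 / (1 - 8 * ε) * N * thomaeTerm a δ α β N k := by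
  have hK : 0 ≤ K := (abs_nonneg _).trans hα
  have hN0 : (0 : ℝ) ≤ N := Nat.cast_nonneg N
  have hεN : ε * N ≤ 1 / 16 * N := mul_le_mul_of_nonneg_right hε' hN0
  have hNpos : (0 : ℝ) < N := by linarith
  rw [abs_le] at hk
  have hpos : 0 < thomaeTerm a δ α β N k := thomaeTerm_pos ha hδ hα hβ (by linarith)
  rw [abs_le] at hα
  have hkN : k ≤ N := by
    have : (k : ℝ) ≤ N := by linarith
    exact_mod_cast this
  have h := thomaeTerm_param_succ a δ α β hkN
  set T := thomaeTerm a δ α β N k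
  have hu : 0 < (N : ℝ) + 1 - k := by linarith
  have hεu : ε * N ≤ 2 * (ε * (N + 1 - k)) := by
    have := mul_le_mul_of_nonneg_left (show (N : ℝ) ≤ 2 * (N + 1 - k) by linarith) hε.le
    linarith
  -- The errors in α+1 and k total at most εN + (K+1) ≤ 5εN/4, within the allowance 8ε·N/4 = 2εN.
  have hw1 : (1 - 8 * ε) * (N / 4) ≤ α + 1 - k := by linarith
  have hw2 : α + 1 - k ≤ (1 + 8 * ε) * (N / 4) := by linarith
  have hw : 0 < α + 1 - k := by linarith
  have hX : 0 < ((N : ℝ) + 1 - k) * (α + 1 - k) := mul_pos hu hw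
  have hα1 : α + 1 ≤ (1 + ε) * (N / 2) := by linarith
  have hα2 : (1 - ε) * (N / 2) ≤ α + 1 := by linarith
  have hv1 : δ + (N - k) ≤ (1 + ε) * (N + 1 - k) := by linarith
  have hv2 : (1 - ε) * (N + 1 - k) ≤ δ + (N - k) := by linarith
  constructor
  · refine le_of_mul_le_mul_right ?_ hX
    rw [h]
    have h1 : 2 * (1 - ε) ^ 2 / (1 + 8 * ε) * N * (((N : ℝ) + 1 - k) * (α + 1 - k)) ≤
        (N + 1) * (δ + (N - k)) * (α + 1) := by
      calc _ ≤ 2 * (1 - ε) ^ 2 / (1 + 8 * ε) * N *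
            (((N : ℝ) + 1 - k) * ((1 + 8 * ε) * (N / 4))) := by
            refine mul_le_mul_of_nonneg_left ?_ (by positivity)
            exact mul_le_mul_of_nonneg_left hw2 hu.le
        _ = N * ((1 - ε) * (N + 1 - k)) * ((1 - ε) * (N / 2)) := by
            field_simp
            ring
        _ ≤ _ := by
            refine mul_le_mul ?_ hα2 (mul_nonneg (by linarith) (by linarith)) (by nlinarith)
            exact mul_le_mul (by linarith) hv2 (mul_nonneg (by linarith) hu.le) (by linarith)
    calc _ = T * (2 * (1 - ε) ^ 2 / (1 + 8 * ε) * N * (((N : ℝ) + 1 - k) * (α + 1 - k))) := by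
          ring
      _ ≤ _ := mul_le_mul_of_nonneg_left h1 hpos.le
  · refine le_of_mul_le_mul_right ?_ hX
    rw [h]
    have h8 : 0 < 1 - 8 * ε := by linarith
    have h1 : (N + 1) * (δ + (N - k)) * (α + 1) ≤
        2 * (1 + ε) ^ 3 / (1 - 8 * ε) * N * (((N : ℝ) + 1 - k) * (α + 1 - k)) := by
      calc _ ≤ ((1 + ε) * N) * ((1 + ε) * (N + 1 - k)) * ((1 + ε) * (N / 2)) := by
            refine mul_le_mul ?_ hα1 (by linarith) (by positivity)
            exact mul_le_mul (by linarith) hv1 (by linarith) (by positivity)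
        _ = 2 * (1 + ε) ^ 3 / (1 - 8 * ε) * N *
            (((N : ℝ) + 1 - k) * ((1 - 8 * ε) * (N / 4))) := by
            have h9 := h8.ne'
            generalize 1 - 8 * ε = w at h9 ⊢
            field_simp
            ring
        _ ≤ _ := by
            refine mul_le_mul_of_nonneg_left ?_ (by positivity)
            exact mul_le_mul_of_nonneg_left hw1 hu.le
    calc _ ≤ T * (2 * (1 + ε) ^ 3 / (1 - 8 * ε) * N * (((N : ℝ) + 1 - k) * (α + 1 - k))) :=
          mul_le_mul_of_nonneg_left h1 hpos.le
      _ = _ := by ring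

theorem sum_thomaeTerm_ratio_bounds {a δ : ℝ} (ha : 0 < a) (hδ : 0 < δ) {K : ℝ} {α β : ℕ → ℝ}
    (hα : ∀ N : ℕ, |α N - N / 2| ≤ K) (hβ : ∀ N : ℕ, |β N - N / 2| ≤ K)
    (hstep : ∀ N : ℕ, 1 ≤ N → (α (N + 1) = α N + 1 ∧ β (N + 1) = β N) ∨
      (α (N + 1) = α N ∧ β (N + 1) = β N + 1)) {ε : ℝ} (hε : 0 < ε) (hε' : ε ≤ 1 / 16) :
    ∀ᶠ N : ℕ in atTop,
      2 * (1 - ε) ^ 2 / (1 + 8 * ε) * ((1 - ε) / (1 + ε)) ≤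
          (∑ k ∈ Finset.range (N + 1 + 1), thomaeTerm a δ (α (N + 1)) (β (N + 1)) (N + 1) k) /
            (N * ∑ k ∈ Finset.range (N + 1), thomaeTerm a δ (α N) (β N) N k) ∧
        (∑ k ∈ Finset.range (N + 1 + 1), thomaeTerm a δ (α (N + 1)) (β (N + 1)) (N + 1) k) /
            (N * ∑ k ∈ Finset.range (N + 1), thomaeTerm a δ (α N) (β N) N k) ≤
          2 * (1 + ε) ^ 3 / (1 - 8 * ε) * ((1 + ε) / (1 - ε)) := by
  filter_upwards [thomaeTerm_dominated ha hδ K hε hε' hε,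
    (tendsto_add_atTop_nat 1).eventually
      (thomaeTerm_dominated ha hδ K (half_pos hε) (by linarith) hε),
    eventually_le_mul_natCast (4 * (K + 1)) hε, eventually_le_mul_natCast (2 * δ) hε,
    eventually_ge_atTop 1] with N hdom hdom' hNK hNδ hN1
  have hK : 0 ≤ K := (abs_nonneg _).trans (hα 0)
  have hN0 : (0 : ℝ) ≤ N := Nat.cast_nonneg N
  have hεN : ε * N ≤ 1 / 16 * N := mul_le_mul_of_nonneg_right hε' hN0
  have hNpos : (0 : ℝ) < N := by linarith
  -- A single window serves both N and N+1, so that the two sums can be compared term by term.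
  set Z := (Finset.range (N + 1)).filter fun k : ℕ => |(k : ℝ) - N / 4| ≤ ε * N with hZ
  have hZmem : ∀ k : ℕ, k ∈ Z ↔ k ≤ N ∧ |(k : ℝ) - N / 4| ≤ ε * N := by
    intro k
    rw [hZ, Finset.mem_filter, Finset.mem_range, Nat.lt_succ_iff]
  set t := thomaeTerm a δ (α N) (β N) N
  set t' := thomaeTerm a δ (α (N + 1)) (β (N + 1)) (N + 1)
  have hpos : ∀ k ∈ Z, 0 < t k := by
    intro k hk
    have := abs_le.1 ((hZmem k).1 hk).2
    exact thomaeTerm_pos ha hδ (hα N) (hβ N) (by linarith)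
  have hpos' : ∀ k ∈ Z, 0 < t' k := by
    intro k hk
    have := abs_le.1 ((hZmem k).1 hk).2
    refine thomaeTerm_pos ha hδ (hα (N + 1)) (hβ (N + 1)) ?_
    push_cast
    linarith
  have hZne : Z.Nonempty := by
    refine ⟨⌊(N : ℝ) / 4⌋₊, (hZmem _).2 ⟨?_, ?_⟩⟩
    · exact Nat.floor_le_of_le (by linarith)
    · have h1 := Nat.floor_le (show 0 ≤ (N : ℝ) / 4 by positivity)
      have h2 := Nat.lt_floor_add_one ((N : ℝ) / 4)
      rw [abs_le]
      constructor <;> linarith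
  have hS := abs_sum_sub_le_of_dominated (t := t) hε.le (Finset.filter_subset _ _)
    (fun k hk => (hpos k hk).le) (fun k hk hkZ => by
      have hout : ε * N < |(k : ℝ) - N / 4| := by
        by_contra hcon
        exact hkZ ((hZmem k).2 ⟨hk, not_lt.1 hcon⟩)
      obtain ⟨m, hm, hm1, hm2⟩ := hdom _ _ (hα N) (hβ N) k hk hout
      exact ⟨m, (hZmem m).2 ⟨hm, hm1⟩, hm2⟩)
  -- The window for N+1 was taken with half the width ε/2 so that it fits inside Z despite the
  -- shifted centre.
  have hsub : ∀ m : ℕ, |(m : ℝ) - (N + 1 : ℕ) / 4| ≤ ε / 2 * (N + 1 : ℕ) → m ∈ Z := by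
    intro m hm
    push_cast at hm
    rw [abs_le] at hm
    refine (hZmem m).2 ⟨?_, ?_⟩
    · have : (m : ℝ) ≤ N := by linarith
      exact_mod_cast this
    · rw [abs_le]
      constructor <;> linarith
  have hS' := abs_sum_sub_le_of_dominated (N := N + 1) (t := t') hε.le
    ((Finset.filter_subset _ _).trans (Finset.range_mono (by omega)))
    (fun k hk => (hpos' k hk).le) (fun k hk hkZ => by
      have hout : ε / 2 * (N + 1 : ℕ) < |(k : ℝ) - (N + 1 : ℕ) / 4| := by
        by_contra hcon
        exact hkZ (hsub k (not_lt.1 hcon))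
      obtain ⟨m, hm, hm1, hm2⟩ := hdom' _ _ (hα (N + 1)) (hβ (N + 1)) k hk hout
      exact ⟨m, hsub m hm1, hm2⟩)
  have hterm : ∀ k ∈ Z, 2 * (1 - ε) ^ 2 / (1 + 8 * ε) * N * t k ≤ t' k ∧
      t' k ≤ 2 * (1 + ε) ^ 3 / (1 - 8 * ε) * N * t k := by
    intro k hk
    have hk2 := ((hZmem k).1 hk).2
    rcases hstep N hN1 with ⟨h1, h2⟩ | ⟨h1, h2⟩
    · simp only [t, t', h1, h2]
      exact thomaeTerm_param_succ_bounds ha hδ hε hε' (hα N) (hβ N) hNK hNδ hk2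
    · simp only [t, t', h1, h2]
      rw [thomaeTerm_comm a δ (α N), thomaeTerm_comm a δ (α N)]
      exact thomaeTerm_param_succ_bounds ha hδ hε hε' (hβ N) (hα N) hNK hNδ hk2
  set W := ∑ k ∈ Z, t k
  set W' := ∑ k ∈ Z, t' k
  have hW : 0 < W := Finset.sum_pos hpos hZne
  have hlo : 2 * (1 - ε) ^ 2 / (1 + 8 * ε) * N * W ≤ W' := by
    rw [Finset.mul_sum]
    exact Finset.sum_le_sum fun k hk => (hterm k hk).1
  have hhi : W' ≤ 2 * (1 + ε) ^ 3 / (1 - 8 * ε) * N * W := by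
    rw [Finset.mul_sum]
    exact Finset.sum_le_sum fun k hk => (hterm k hk).2
  set S := ∑ k ∈ Finset.range (N + 1), t k
  set S' := ∑ k ∈ Finset.range (N + 1 + 1), t' k
  rw [abs_le] at hS hS'
  have h8 : 0 < 1 - 8 * ε := by linarith
  have hε1 : 0 < 1 - ε := by linarith
  have hS1 : (1 - ε) * W ≤ S := by linarith
  have hS2 : S ≤ (1 + ε) * W := by linarith
  have hSpos : 0 < S := lt_of_lt_of_le (mul_pos hε1 hW) hS1
  set lo := 2 * (1 - ε) ^ 2 / (1 + 8 * ε) with hlo_def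
  set hi := 2 * (1 + ε) ^ 3 / (1 - 8 * ε) with hhi_def
  have hlo0 : 0 ≤ lo := by positivity
  have hhi0 : 0 ≤ hi := by positivity
  constructor
  · rw [le_div_iff₀ (by positivity)]
    calc _ ≤ lo * ((1 - ε) / (1 + ε)) * (N * ((1 + ε) * W)) := by gcongr
      _ = (1 - ε) * (lo * N * W) := by field_simp
      _ ≤ (1 - ε) * W' := mul_le_mul_of_nonneg_left hlo hε1.le
      _ ≤ S' := by linarith
  · rw [div_le_iff₀ (by positivity)]
    calc S' ≤ (1 + ε) * W' := by linarith
      _ ≤ (1 + ε) * (hi * N * W) := mul_le_mul_of_nonneg_left hhi (by linarith)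
      _ = hi * ((1 + ε) / (1 - ε)) * (N * ((1 - ε) * W)) := by field_simp
      _ ≤ _ := by gcongr

theorem tendsto_sum_thomaeTerm_ratio {a δ : ℝ} (ha : 0 < a) (hδ : 0 < δ) {K : ℝ} {α β : ℕ → ℝ}
    (hα : ∀ N : ℕ, |α N - N / 2| ≤ K) (hβ : ∀ N : ℕ, |β N - N / 2| ≤ K)
    (hstep : ∀ N : ℕ, 1 ≤ N → (α (N + 1) = α N + 1 ∧ β (N + 1) = β N) ∨
      (α (N + 1) = α N ∧ β (N + 1) = β N + 1)) :
    Tendsto (fun N : ℕ =>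
      (∑ k ∈ Finset.range (N + 1 + 1), thomaeTerm a δ (α (N + 1)) (β (N + 1)) (N + 1) k) /
        (N * ∑ k ∈ Finset.range (N + 1), thomaeTerm a δ (α N) (β N) N k)) atTop (𝓝 2) := by
  have hlo : Tendsto (fun ε : ℝ => 2 * (1 - ε) ^ 2 / (1 + 8 * ε) * ((1 - ε) / (1 + ε)))
      (𝓝[>] 0) (𝓝 2) := by
    have : ContinuousAt (fun ε : ℝ => 2 * (1 - ε) ^ 2 / (1 + 8 * ε) * ((1 - ε) / (1 + ε))) 0 := by
      fun_prop (disch := norm_num)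
    have h := this.tendsto.mono_left (nhdsWithin_le_nhds (s := Set.Ioi 0))
    norm_num at h
    exact h
  have hhi : Tendsto (fun ε : ℝ => 2 * (1 + ε) ^ 3 / (1 - 8 * ε) * ((1 + ε) / (1 - ε)))
      (𝓝[>] 0) (𝓝 2) := by
    have : ContinuousAt (fun ε : ℝ => 2 * (1 + ε) ^ 3 / (1 - 8 * ε) * ((1 + ε) / (1 - ε))) 0 := by
      fun_prop (disch := norm_num)
    have h := this.tendsto.mono_left (nhdsWithin_le_nhds (s := Set.Ioi 0))
    norm_num at h
    exact h
  have hsmall : ∀ᶠ ε : ℝ in 𝓝[>] 0, 0 < ε ∧ ε ≤ 1 / 16 :=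
    Ioc_mem_nhdsGT (by norm_num)
  rw [tendsto_order]
  constructor
  · intro x hx
    obtain ⟨ε, ⟨h1, h2⟩, h3⟩ := (hsmall.and (hlo.eventually_const_lt hx)).exists
    filter_upwards [sum_thomaeTerm_ratio_bounds ha hδ hα hβ hstep h1 h2] with N hN
    exact h3.trans_le hN.1
  · intro x hx
    obtain ⟨ε, ⟨h1, h2⟩, h3⟩ := (hsmall.and (hhi.eventually_lt_const hx)).exists
    filter_upwards [sum_thomaeTerm_ratio_bounds ha hδ hα hβ hstep h1 h2] with N hN
    exact hN.2.trans_lt h3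

/-! ### Linear forms, existence and uniqueness -/

/-- The linear form `P ↦ ∑ⱼ pⱼ m (j + k)`, that is `P ↦ L (xᵏ P)` for the functional `L` with
moments `m`. -/
noncomputable def momentForm (m : ℕ → ℝ) (k : ℕ) : ℝ[X] →ₗ[ℝ] ℝ :=
  Polynomial.lsum fun j => LinearMap.mulRight ℝ (m (j + k))

theorem momentForm_apply (m : ℕ → ℝ) (k : ℕ) (P : ℝ[X]) :
    momentForm m k P = P.sum fun j p => p * m (j + k) := rfl

theorem momentForm_monomial (m : ℕ → ℝ) (k j : ℕ) (p : ℝ) :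
    momentForm m k (monomial j p) = p * m (j + k) := by
  exact sum_monomial_index p (fun j p => p * m (j + k)) (zero_mul _)

/-- Triangularity: subtracting a multiple of `E N` lowers the degree without disturbing the earlier
forms, so P is that multiple by induction, and the form `Λ N` forces the multiple to vanish. -/
theorem eq_zero_of_forms_eq_zero {Λ : ℕ → ℝ[X] →ₗ[ℝ] ℝ} {E : ℕ → ℝ[X]}
    (hdeg : ∀ N, (E N).natDegree = N) (hE : ∀ N, E N ≠ 0) (h0 : ∀ N i, i < N → Λ i (E N) = 0)
    (h1 : ∀ N, Λ N (E N) ≠ 0) {N : ℕ} {P : ℝ[X]} (hP : P.degree < N)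
    (hΛ : ∀ i < N, Λ i P = 0) : P = 0 := by
  induction N generalizing P with
  | zero =>
    rw [Nat.cast_zero] at hP
    by_contra h
    exact absurd (zero_le_degree_iff.2 h) (not_le.2 hP)
  | succ N ih =>
    have hlc : (E N).coeff N ≠ 0 := by
      have := leadingCoeff_ne_zero.2 (hE N)
      rwa [leadingCoeff, hdeg] at this
    set q := P.coeff N / (E N).coeff N with hq
    have hR : P - q • E N = 0 := by
      refine ih ?_ fun i hi => ?_
      · rw [degree_lt_iff_coeff_zero]
        intro m hm
        rw [coeff_sub, coeff_smul, smul_eq_mul]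
        rcases hm.eq_or_lt with rfl | hlt
        · rw [hq, div_mul_cancel₀ _ hlc, sub_self]
        · rw [(degree_lt_iff_coeff_zero _ _).1 hP m hlt,
            coeff_eq_zero_of_natDegree_lt (by rw [hdeg]; exact hlt), mul_zero, sub_zero]
      · rw [map_sub, map_smul, hΛ i (by omega), h0 N i hi, smul_zero, sub_zero]
    rw [sub_eq_zero] at hR
    have h := hΛ N (Nat.lt_succ_self N)
    rw [hR, map_smul, smul_eq_mul] at h
    rw [hR, (mul_eq_zero.1 h).resolve_right (h1 N), zero_smul]

/-- The polynomial `₃F₂(-N, c + ⌊N/2⌋, d + ⌊(N-1)/2⌋; a, b; x)`. -/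
noncomputable def typeIIPoly (a b c d : ℝ) (N : ℕ) : ℝ[X] :=
  ∑ j ∈ Finset.range (N + 1), monomial j (typeIICoeff a b c d N j)

theorem coeff_typeIIPoly (a b c d : ℝ) (N j : ℕ) :
    (typeIIPoly a b c d N).coeff j = typeIICoeff a b c d N j := by
  simp only [typeIIPoly, finsetSum_coeff, coeff_monomial]
  rw [Finset.sum_ite_eq']
  split_ifs with h
  · rfl
  · rw [typeIICoeff, Nat.choose_eq_zero_of_lt (by simpa using h)]
    simp

theorem eval_one_typeIIPoly (a b c d : ℝ) (N : ℕ) :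
    (typeIIPoly a b c d N).eval 1 =
      hyp3F2 (-(N : ℝ)) (c + (N / 2 : ℕ)) (d + ((N - 1) / 2 : ℕ)) a b 1 := by
  rw [hyp3F2_neg_natCast, typeIIPoly, eval_finsetSum]
  refine Finset.sum_congr rfl fun j _ => ?_
  rw [eval_monomial, typeIICoeff]

section Orthogonality

variable {a b c d : ℝ}

/-- The orthogonality conditions on the step-line: `∫ P xᵏ W₁` for `i = 2k` and `∫ P xᵏ W₂` for
`i = 2k + 1`. -/
noncomputable def stepForm (a b c d : ℝ) (i : ℕ) : ℝ[X] →ₗ[ℝ] ℝ :=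
  momentForm (if Even i then hypMoment a b c d else hypMoment a (b + 1) (c + 1) d) (i / 2)

theorem typeIICoeff_self_ne_zero (ha : 0 < a) (hb : 0 < b) (hc : ∀ k : ℕ, c ≠ -(k : ℝ))
    (hd : ∀ k : ℕ, d ≠ -(k : ℝ)) (N : ℕ) : typeIICoeff a b c d N N ≠ 0 := by
  rw [typeIICoeff, Nat.choose_self]
  refine mul_ne_zero (by simp) (div_ne_zero (mul_ne_zero ?_ ?_) ?_)
  · exact poch_ne_zero (fun k h => hc (N / 2 + k) (by push_cast at h ⊢; linarith)) _
  · exact poch_ne_zero (fun k h => hd ((N - 1) / 2 + k) (by push_cast at h ⊢; linarith)) _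
  · exact mul_ne_zero (poch_pos ha N).ne' (poch_pos hb N).ne'

theorem natDegree_typeIIPoly (ha : 0 < a) (hb : 0 < b) (hc : ∀ k : ℕ, c ≠ -(k : ℝ))
    (hd : ∀ k : ℕ, d ≠ -(k : ℝ)) (N : ℕ) : (typeIIPoly a b c d N).natDegree = N := by
  refine natDegree_eq_of_le_of_coeff_ne_zero ?_ ?_
  · rw [natDegree_le_iff_coeff_eq_zero]
    intro m hm
    rw [coeff_typeIIPoly, typeIICoeff, Nat.choose_eq_zero_of_lt hm]
    simp
  · rw [coeff_typeIIPoly]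
    exact typeIICoeff_self_ne_zero ha hb hc hd N

theorem stepForm_typeIIPoly (ha : 0 < a) (hb : 0 < b) (hδ : 0 < c + d - a - b)
    (hc : ∀ k : ℕ, c ≠ -(k : ℝ)) (hd : ∀ k : ℕ, d ≠ -(k : ℝ)) (i : ℕ) :
    ∃ ν : ℝ, ν ≠ 0 ∧ ∀ N, stepForm a b c d i (typeIIPoly a b c d N) =
      ν * ∑ j ∈ Finset.range (N + 1), typeIICoeff a b c d N j * stepRatio a b c d i j := by
  have hc' : ∀ k : ℕ, c + 1 ≠ -(k : ℝ) := fun k h => hc (k + 1) (by push_cast; linarith)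
  have hb' : 0 < b + 1 := by linarith
  have hδ' : 0 < c + 1 + d - a - (b + 1) := by linarith
  have hc0 : c ≠ 0 := by simpa using hc 0
  have key : ∃ ν : ℝ, ν ≠ 0 ∧ ∀ j,
      (if Even i then hypMoment a b c d else hypMoment a (b + 1) (c + 1) d) (j + i / 2) =
        ν * stepRatio a b c d i j := by
    rcases Nat.even_or_odd' i with ⟨k, rfl | rfl⟩
    · refine ⟨_, hypMoment_ne_zero ha hb hδ hc hd 0, fun j => ?_⟩
      rw [if_pos (even_two_mul k), hypMoment_eq_poch ha hb hδ hc hd, stepRatio,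
        show 2 * k / 2 = k by omega, show (2 * k + 1) / 2 = k by omega]
    -- The factor c/b comes from (b+1)ₘ = (b)ₘ₊₁/b and (c+1)ₘ = (c)ₘ₊₁/c.
    · refine ⟨hypMoment a (b + 1) (c + 1) d 0 * (c / b),
        mul_ne_zero (hypMoment_ne_zero ha hb' hδ' hc' hd 0) (div_ne_zero hc0 hb.ne'),
        fun j => ?_⟩
      rw [if_neg (by simp), hypMoment_eq_poch ha hb' hδ' hc' hd, stepRatio,
        show (2 * k + 1) / 2 = k by omega, show (2 * k + 1 + 1) / 2 = k + 1 by omega,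
        ← add_assoc, poch_succ' b, poch_succ' c]
      have h1 := poch_ne_zero hc' (j + k)
      have h2 := poch_ne_zero hd (j + k)
      field_simp
  obtain ⟨ν, hν, h⟩ := key
  refine ⟨ν, hν, fun N => ?_⟩
  rw [stepForm, typeIIPoly, map_sum, Finset.mul_sum]
  refine Finset.sum_congr rfl fun j _ => ?_
  rw [momentForm_monomial, h]
  ring

/-- Interleaving the two families by parity turns the step-line conditions into the first n members
of one sequence; W₂ meets the same hypotheses because δ is unchanged. -/
theorem isTypeII_iff (ha : 0 < a) (hb : 0 < b) (hδ : 0 < c + d - a - b)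
    (hc : ∀ k : ℕ, c ≠ -(k : ℝ)) (hd : ∀ k : ℕ, d ≠ -(k : ℝ)) (n : ℕ) (P : ℝ[X]) :
    IsTypeII a b c d n P ↔
      P.Monic ∧ P.natDegree = n ∧ ∀ i < n, stepForm a b c d i P = 0 := by
  have hc' : ∀ k : ℕ, c + 1 ≠ -(k : ℝ) := fun k h => hc (k + 1) (by push_cast; linarith)
  have h1 : ∀ k, ∫ x in (0 : ℝ)..1, P.eval x * x ^ k * hypW1 a b c d x =
      stepForm a b c d (2 * k) P := by
    intro k
    rw [stepForm, if_pos (even_two_mul k), show 2 * k / 2 = k by omega, momentForm_apply]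
    exact integral_eval_mul_hypWeight ha hb hδ hc hd P k
  have h2 : ∀ k, ∫ x in (0 : ℝ)..1, P.eval x * x ^ k * hypW2 a b c d x =
      stepForm a b c d (2 * k + 1) P := by
    intro k
    rw [stepForm, if_neg (by simp), show (2 * k + 1) / 2 = k by omega, momentForm_apply]
    exact integral_eval_mul_hypWeight ha (by linarith) (by linarith) hc' hd P k
  constructor
  · rintro ⟨hm, hdeg, ho1, ho2⟩
    refine ⟨hm, hdeg, fun i hi => ?_⟩
    rcases Nat.even_or_odd' i with ⟨k, rfl | rfl⟩
    · rw [← h1]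
      exact ho1 k (by omega)
    · rw [← h2]
      exact ho2 k (by omega)
  · rintro ⟨hm, hdeg, ho⟩
    exact ⟨hm, hdeg, fun k hk => by rw [h1]; exact ho _ (by omega),
      fun k hk => by rw [h2]; exact ho _ (by omega)⟩

variable (ha : 0 < a) (hb : 0 < b) (hδ : 0 < c + d - a - b)
  (hc : ∀ k : ℕ, c ≠ -(k : ℝ)) (hd : ∀ k : ℕ, d ≠ -(k : ℝ))
  (hda : ∀ k : ℕ, d - a ≠ -(k : ℝ)) (hdb : ∀ k : ℕ, d - b ≠ -(k : ℝ))
  (hca : ∀ k : ℕ, c + 1 - a ≠ -(k : ℝ)) (hcb : ∀ k : ℕ, c - b ≠ -(k : ℝ))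

include ha hb hδ hc hd

theorem isTypeII_normalized_typeIIPoly (n : ℕ) :
    IsTypeII a b c d n ((typeIICoeff a b c d n n)⁻¹ • typeIIPoly a b c d n) := by
  have hlc := typeIICoeff_self_ne_zero ha hb hc hd n
  have hdeg := natDegree_typeIIPoly ha hb hc hd n
  have hdeg' : ((typeIICoeff a b c d n n)⁻¹ • typeIIPoly a b c d n).natDegree = n := by
    rw [natDegree_smul _ (inv_ne_zero hlc), hdeg]
  refine (isTypeII_iff ha hb hδ hc hd n _).2 ⟨?_, hdeg', fun i hi => ?_⟩
  · rw [Monic, leadingCoeff, hdeg', coeff_smul, coeff_typeIIPoly, smul_eq_mul,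
      inv_mul_cancel₀ hlc]
  · obtain ⟨ν, -, h⟩ := stepForm_typeIIPoly ha hb hδ hc hd i
    have ha' : ∀ k : ℕ, a ≠ -(k : ℝ) := fun k h => by
      linarith [Nat.cast_nonneg (α := ℝ) k]
    have hb' : ∀ k : ℕ, b ≠ -(k : ℝ) := fun k h => by
      linarith [Nat.cast_nonneg (α := ℝ) k]
    rw [map_smul, h, sum_typeIICoeff_mul_stepRatio_eq_zero ha' hb' hc hd hi, mul_zero, smul_zero]

include hda hdb hca hcb

theorem IsTypeII.unique {n : ℕ} {P Q : ℝ[X]} (hP : IsTypeII a b c d n P)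
    (hQ : IsTypeII a b c d n Q) : P = Q := by
  rw [isTypeII_iff ha hb hδ hc hd] at hP hQ
  have ha' : ∀ k : ℕ, a ≠ -(k : ℝ) := fun k h => by
    linarith [Nat.cast_nonneg (α := ℝ) k]
  have hb' : ∀ k : ℕ, b ≠ -(k : ℝ) := fun k h => by
    linarith [Nat.cast_nonneg (α := ℝ) k]
  rw [← sub_eq_zero]
  refine eq_zero_of_forms_eq_zero (Λ := stepForm a b c d) (E := typeIIPoly a b c d) (N := n)
    (natDegree_typeIIPoly ha hb hc hd) (fun N h => ?_) (fun N i hi => ?_) (fun N => ?_) ?_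
    fun i hi => ?_
  · have := coeff_typeIIPoly a b c d N N
    rw [h, coeff_zero] at this
    exact typeIICoeff_self_ne_zero ha hb hc hd N this.symm
  · obtain ⟨ν, -, h⟩ := stepForm_typeIIPoly ha hb hδ hc hd i
    rw [h, sum_typeIICoeff_mul_stepRatio_eq_zero ha' hb' hc hd hi, mul_zero]
  · obtain ⟨ν, hν, h⟩ := stepForm_typeIIPoly ha hb hδ hc hd N
    rw [h]
    exact mul_ne_zero hν
      (sum_typeIICoeff_mul_stepRatio_self_ne_zero ha' hb' hc hd hda hdb hca hcb N)
  · have hPd : P.degree = n := by rw [degree_eq_natDegree hP.1.ne_zero, hP.2.1]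
    have hQd : Q.degree = n := by rw [degree_eq_natDegree hQ.1.ne_zero, hQ.2.1]
    rw [← hPd]
    exact degree_sub_lt_left (hPd.trans hQd.symm) hP.1.ne_zero (hP.1.trans hQ.1.symm)
  · rw [map_sub, hP.2.2 i hi, hQ.2.2 i hi, sub_zero]

end Orthogonality

/-! ### Ratio asymptotics at 1 and of the leading coefficients -/

section Asymptotics

theorem tendsto_div_natCast_of_abs_sub_le {u : ℕ → ℝ} {l K : ℝ}
    (h : ∀ N : ℕ, |u N - l * N| ≤ K) : Tendsto (fun N : ℕ => u N / N) atTop (𝓝 l) := by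
  have hK : Tendsto (fun N : ℕ => K / (N : ℝ)) atTop (𝓝 0) :=
    tendsto_const_div_atTop_nhds_zero_nat K
  rw [tendsto_iff_norm_sub_tendsto_zero]
  refine squeeze_zero' (Eventually.of_forall fun _ => norm_nonneg _) ?_ hK
  filter_upwards [eventually_gt_atTop 0] with N hN
  have hN' : (0 : ℝ) < N := by exact_mod_cast hN
  rw [Real.norm_eq_abs, le_div_iff₀ hN', ← abs_of_pos hN', ← abs_mul, abs_of_pos hN', sub_mul,
    div_mul_cancel₀ _ hN'.ne']
  exact h N

theorem abs_natCast_half_sub_le (x : ℝ) (N : ℕ) : |x + (N / 2 : ℕ) - N / 2| ≤ |x| + 1 := by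
  have h1 : ((N / 2 : ℕ) : ℝ) * 2 ≤ N := by
    exact_mod_cast Nat.div_mul_le_self N 2
  have h2 : (N : ℝ) ≤ (N / 2 : ℕ) * 2 + 1 := by
    have : N ≤ N / 2 * 2 + 1 := by omega
    exact_mod_cast this
  have h3 := neg_abs_le x
  have h4 := le_abs_self x
  rw [abs_le]
  constructor <;> linarith

theorem abs_natCast_pred_half_sub_le (x : ℝ) (N : ℕ) :
    |x + ((N - 1) / 2 : ℕ) - N / 2| ≤ |x| + 1 := by
  have h1 : (((N - 1) / 2 : ℕ) : ℝ) * 2 ≤ N := by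
    have : (N - 1) / 2 * 2 ≤ N := by omega
    exact_mod_cast this
  have h2 : (N : ℝ) ≤ ((N - 1) / 2 : ℕ) * 2 + 2 := by
    have : N ≤ (N - 1) / 2 * 2 + 2 := by omega
    exact_mod_cast this
  have h3 := neg_abs_le x
  have h4 := le_abs_self x
  rw [abs_le]
  constructor <;> linarith

variable {a b c d : ℝ}

theorem tendsto_hyp3F2_ratio (ha : 0 < a) (hb : 0 < b) (hδ : 0 < c + d - a - b) :
    Tendsto (fun N : ℕ =>
      hyp3F2 (-((N + 1 : ℕ) : ℝ)) (c + ((N + 1) / 2 : ℕ)) (d + ((N + 1 - 1) / 2 : ℕ)) a b 1 /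
        hyp3F2 (-(N : ℝ)) (c + (N / 2 : ℕ)) (d + ((N - 1) / 2 : ℕ)) a b 1) atTop (𝓝 (-2)) := by
  have hmain := tendsto_sum_thomaeTerm_ratio ha hδ (K := |c - a| + |d - a| + 1)
    (α := fun N => c + (N / 2 : ℕ) - a) (β := fun N => d + ((N - 1) / 2 : ℕ) - a)
    (fun N => by
      have h := abs_natCast_half_sub_le (c - a) N
      rw [show c - a + ((N / 2 : ℕ) : ℝ) = c + (N / 2 : ℕ) - a by ring] at h
      linarith [abs_nonneg (d - a)])
    (fun N => by
      have h := abs_natCast_pred_half_sub_le (d - a) N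
      rw [show d - a + (((N - 1) / 2 : ℕ) : ℝ) = d + ((N - 1) / 2 : ℕ) - a by ring] at h
      linarith [abs_nonneg (c - a)])
    -- Parity decides which of the two floors advances. At N = 0 truncated subtraction lets neither
    -- advance, hence the restriction to N ≥ 1.
    (fun N hN => by
      rcases Nat.even_or_odd' N with ⟨n, rfl | rfl⟩
      · right
        obtain ⟨m, rfl⟩ : ∃ m, n = m + 1 := ⟨n - 1, by omega⟩
        rw [show (2 * (m + 1) + 1) / 2 = m + 1 by omega, show 2 * (m + 1) / 2 = m + 1 by omega,
          show (2 * (m + 1) + 1 - 1) / 2 = m + 1 by omega,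
          show (2 * (m + 1) - 1) / 2 = m by omega]
        push_cast
        exact ⟨rfl, by ring⟩
      · left
        rw [show (2 * n + 1 + 1) / 2 = n + 1 by omega, show (2 * n + 1) / 2 = n by omega,
          show (2 * n + 1 + 1 - 1) / 2 = n by omega, show (2 * n + 1 - 1) / 2 = n by omega]
        push_cast
        exact ⟨by ring, rfl⟩)
  have hN : Tendsto (fun N : ℕ => (b + N) / (N : ℝ)) atTop (𝓝 1) :=
    tendsto_div_natCast_of_abs_sub_le (K := |b|) fun N => by simp
  have hlim := (hmain.div hN one_ne_zero).neg
  rw [div_one] at hlim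
  refine hlim.congr' ?_
  filter_upwards [eventually_ge_atTop 1] with N hN1
  have hsum : ∀ M : ℕ, 1 ≤ M → (c + (M / 2 : ℕ)) + (d + ((M - 1) / 2 : ℕ)) =
      a + b + (c + d - a - b) + M - 1 := by
    intro M hM
    have : M / 2 + (M - 1) / 2 + 1 = M := by omega
    have h : ((M / 2 : ℕ) : ℝ) + ((M - 1) / 2 : ℕ) + 1 = M := by exact_mod_cast this
    linarith
  have e1 := hyp3F2_eq_sum_thomaeTerm ha hb (hsum N hN1)
  have e2 := hyp3F2_eq_sum_thomaeTerm ha hb (hsum (N + 1) (by omega))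
  have hp := (poch_pos hb N).ne'
  have hbN : b + N ≠ 0 := by positivity
  have hN0 : (N : ℝ) ≠ 0 := by
    have : N ≠ 0 := by omega
    exact_mod_cast this
  rw [poch_succ] at e2
  rw [eq_div_of_mul_eq hp ((mul_comm _ _).trans e1),
    eq_div_of_mul_eq (mul_ne_zero hp hbN) ((mul_comm _ _).trans e2)]
  simp only [Pi.div_apply]
  set S := ∑ k ∈ Finset.range (N + 1), thomaeTerm a (c + d - a - b) (c + (N / 2 : ℕ) - a)
    (d + ((N - 1) / 2 : ℕ) - a) N k
  -- If S = 0 both sides are 0 by the convention on division, so no positivity of S is needed here.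
  by_cases hS : S = 0
  · simp [hS]
  · field_simp
    rw [pow_succ]
    ring

/-- Here x is the upper parameter that grows by 1 from N to N+1 and y the one that stays; naming
them treats both parities at once. -/
theorem typeIICoeff_self_div_succ (ha : 0 < a) (hb : 0 < b) (hc : ∀ k : ℕ, c ≠ -(k : ℝ))
    (hd : ∀ k : ℕ, d ≠ -(k : ℝ)) {N : ℕ} (hN : 1 ≤ N) :
    ∃ x y : ℝ, |x - N / 2| ≤ |c| + |d| + 1 ∧ |y - N / 2| ≤ |c| + |d| + 1 ∧
      typeIICoeff a b c d N N / typeIICoeff a b c d (N + 1) (N + 1) =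
        -((a + N) * (b + N) * x / ((x + N) * (x + N + 1) * (y + N))) := by
  have e0 : ∀ x : ℝ, (∀ k : ℕ, x ≠ -(k : ℝ)) → poch x N / poch x (N + 1) = 1 / (x + N) := by
    intro x hx
    have h1 := poch_ne_zero hx (N + 1)
    rw [poch_succ] at h1 ⊢
    have h2 := left_ne_zero_of_mul h1
    have h3 := right_ne_zero_of_mul h1
    field_simp
  have e1 : ∀ x : ℝ, (∀ k : ℕ, x ≠ -(k : ℝ)) →
      poch x N / poch (x + 1) (N + 1) = x / ((x + N) * (x + N + 1)) := by
    intro x hx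
    have h1 := poch_ne_zero hx (N + 1 + 1)
    have h0 : x * poch (x + 1) (N + 1) = poch x N * (x + N) * (x + N + 1) := by
      rw [← poch_succ', poch_succ, poch_succ]
      push_cast
      ring
    have h2 : poch (x + 1) (N + 1) ≠ 0 := by
      rw [poch_succ'] at h1
      exact right_ne_zero_of_mul h1
    have h3 : x + N ≠ 0 := fun h => hx N (by linarith)
    have h4 : x + N + 1 ≠ 0 := fun h => hx (N + 1) (by push_cast; linarith)
    field_simp
    linear_combination -h0
  have hcs : ∀ n k : ℕ, c + (n : ℝ) ≠ -(k : ℝ) := fun n k h =>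
    hc (n + k) (by push_cast; linarith)
  have hds : ∀ n k : ℕ, d + (n : ℝ) ≠ -(k : ℝ) := fun n k h =>
    hd (n + k) (by push_cast; linarith)
  have hfac : ∀ C D C' D' : ℝ,
      (-1) ^ N * (N.choose N : ℝ) * (poch C N * poch D N / (poch a N * poch b N)) /
        ((-1) ^ (N + 1) * ((N + 1).choose (N + 1) : ℝ) *
          (poch C' (N + 1) * poch D' (N + 1) / (poch a (N + 1) * poch b (N + 1)))) =
      -((a + N) * (b + N) * ((poch C N / poch C' (N + 1)) * (poch D N / poch D' (N + 1)))) := by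
    intro C D C' D'
    have h1 := (poch_pos ha N).ne'
    have h2 := (poch_pos hb N).ne'
    have h3 : a + N ≠ 0 := by positivity
    have h4 : b + N ≠ 0 := by positivity
    have h5 : ((-1 : ℝ) ^ N) ≠ 0 := by simp
    rw [Nat.choose_self, Nat.choose_self, poch_succ a, poch_succ b, pow_succ]
    field_simp
  have b1 := abs_natCast_half_sub_le c N
  have b2 := abs_natCast_pred_half_sub_le d N
  rcases Nat.even_or_odd' N with ⟨n, hn | hn⟩
  · refine ⟨d + ((N - 1) / 2 : ℕ), c + (N / 2 : ℕ), by linarith [abs_nonneg c],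
      by linarith [abs_nonneg d], ?_⟩
    rw [typeIICoeff, typeIICoeff, hfac, show (N + 1) / 2 = N / 2 by omega,
      show (N + 1 - 1) / 2 = (N - 1) / 2 + 1 by omega, Nat.cast_succ, ← add_assoc,
      e0 _ (hcs _), e1 _ (hds _)]
    simp only [div_eq_mul_inv, mul_inv]
    ring
  · refine ⟨c + (N / 2 : ℕ), d + ((N - 1) / 2 : ℕ), by linarith [abs_nonneg d],
      by linarith [abs_nonneg c], ?_⟩
    rw [typeIICoeff, typeIICoeff, hfac, show (N + 1) / 2 = N / 2 + 1 by omega,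
      show (N + 1 - 1) / 2 = (N - 1) / 2 by omega, Nat.cast_succ, ← add_assoc,
      e1 _ (hcs _), e0 _ (hds _)]
    simp only [div_eq_mul_inv, mul_inv]
    ring

theorem tendsto_typeIICoeff_self_ratio (ha : 0 < a) (hb : 0 < b) (hc : ∀ k : ℕ, c ≠ -(k : ℝ))
    (hd : ∀ k : ℕ, d ≠ -(k : ℝ)) :
    Tendsto (fun N : ℕ => typeIICoeff a b c d N N / typeIICoeff a b c d (N + 1) (N + 1)) atTop
      (𝓝 (-(4 / 27))) := by
  -- Dummy values at N = 0 make x and y total functions with uniform bounds.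
  have hex : ∀ N : ℕ, ∃ x y : ℝ, |x - N / 2| ≤ |c| + |d| + 1 ∧ |y - N / 2| ≤ |c| + |d| + 1 ∧
      (1 ≤ N → typeIICoeff a b c d N N / typeIICoeff a b c d (N + 1) (N + 1) =
        -((a + N) * (b + N) * x / ((x + N) * (x + N + 1) * (y + N)))) := by
    intro N
    rcases Nat.eq_zero_or_pos N with rfl | hN
    · exact ⟨0, 0, by simpa using by positivity, by simpa using by positivity, by omega⟩
    · obtain ⟨x, y, h1, h2, h3⟩ := typeIICoeff_self_div_succ ha hb hc hd hN
      exact ⟨x, y, h1, h2, fun _ => h3⟩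
  choose x y hx hy hxy using hex
  set K := |c| + |d| + 1
  have l1 : Tendsto (fun N : ℕ => (a + N) / (N : ℝ)) atTop (𝓝 1) :=
    tendsto_div_natCast_of_abs_sub_le (K := |a|) fun N => by simp
  have l2 : Tendsto (fun N : ℕ => (b + N) / (N : ℝ)) atTop (𝓝 1) :=
    tendsto_div_natCast_of_abs_sub_le (K := |b|) fun N => by simp
  have l3 : Tendsto (fun N : ℕ => x N / (N : ℝ)) atTop (𝓝 (1 / 2)) :=
    tendsto_div_natCast_of_abs_sub_le (K := K) fun N => by
      rw [one_div_mul_eq_div]; exact hx N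
  have l4 : Tendsto (fun N : ℕ => (x N + N) / (N : ℝ)) atTop (𝓝 (3 / 2)) :=
    tendsto_div_natCast_of_abs_sub_le (K := K) fun N => by
      rw [show x N + N - 3 / 2 * N = x N - N / 2 by ring]; exact hx N
  have l5 : Tendsto (fun N : ℕ => (x N + N + 1) / (N : ℝ)) atTop (𝓝 (3 / 2)) :=
    tendsto_div_natCast_of_abs_sub_le (K := K + 1) fun N => by
      rw [show x N + N + 1 - 3 / 2 * N = (x N - N / 2) + 1 by ring]
      refine (abs_add_le _ _).trans ?_
      rw [abs_one]
      linarith [hx N]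
  have l6 : Tendsto (fun N : ℕ => (y N + N) / (N : ℝ)) atTop (𝓝 (3 / 2)) :=
    tendsto_div_natCast_of_abs_sub_le (K := K) fun N => by
      rw [show y N + N - 3 / 2 * N = y N - N / 2 by ring]; exact hy N
  have hlim := (((l1.mul l2).mul l3).div ((l4.mul l5).mul l6) (by norm_num)).neg
  rw [show -((1 : ℝ) * 1 * (1 / 2) / (3 / 2 * (3 / 2) * (3 / 2))) = -(4 / 27) by norm_num] at hlim
  refine hlim.congr' ?_
  filter_upwards [eventually_ge_atTop 1] with N hN
  have hN0 : (N : ℝ) ≠ 0 := by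
    have : N ≠ 0 := by omega
    exact_mod_cast this
  rw [hxy N hN]
  simp only [Pi.div_apply]
  rw [div_mul_div_comm, div_mul_div_comm, div_mul_div_comm, div_mul_div_comm,
    div_div_div_cancel_right₀ (mul_ne_zero (mul_ne_zero hN0 hN0) hN0)]

end Asymptotics

/-! ### The main theorem -/

theorem mainTheorem2 (a b c d : ℝ) (ha : 0 < a) (hb : 0 < b) (hδ : 0 < c + d - a - b)
    (hc : ∀ k : ℕ, c ≠ -(k : ℝ)) (hd : ∀ k : ℕ, d ≠ -(k : ℝ))
    (hda : ∀ k : ℕ, d - a ≠ -(k : ℝ)) (hdb : ∀ k : ℕ, d - b ≠ -(k : ℝ))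
    (hca : ∀ k : ℕ, c + 1 - a ≠ -(k : ℝ)) (hcb : ∀ k : ℕ, c - b ≠ -(k : ℝ)) :
    (∀ n : ℕ, ∃! P : ℝ[X], IsTypeII a b c d n P) ∧
    (∀ B : ℕ → ℝ[X], (∀ n : ℕ, IsTypeII a b c d n (B n)) →
      Tendsto (fun n : ℕ => (B (n + 1)).eval 1 / (B n).eval 1) atTop (𝓝 (8 / 27))) ∧
    Tendsto (fun n : ℕ =>
      hyp3F2 (-(2 * (n : ℝ) + 2)) (c + n + 1) (d + n) a b 1 /
        hyp3F2 (-(2 * (n : ℝ) + 1)) (c + n) (d + n) a b 1) atTop (𝓝 (-2)) := by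
  have hratio := tendsto_hyp3F2_ratio ha hb hδ
  refine ⟨fun n => ⟨_, isTypeII_normalized_typeIIPoly ha hb hδ hc hd n, fun Q hQ =>
    hQ.unique ha hb hδ hc hd hda hdb hca hcb (isTypeII_normalized_typeIIPoly ha hb hδ hc hd n)⟩,
    fun B hB => ?_, ?_⟩
  · have hBe : ∀ n, (B n).eval 1 = (typeIICoeff a b c d n n)⁻¹ *
        hyp3F2 (-(n : ℝ)) (c + (n / 2 : ℕ)) (d + ((n - 1) / 2 : ℕ)) a b 1 := by
      intro n
      rw [(hB n).unique ha hb hδ hc hd hda hdb hca hcb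
        (isTypeII_normalized_typeIIPoly ha hb hδ hc hd n), eval_smul, smul_eq_mul,
        eval_one_typeIIPoly]
    have hlim := hratio.mul (tendsto_typeIICoeff_self_ratio ha hb hc hd)
    rw [show (-2 : ℝ) * -(4 / 27) = 8 / 27 by norm_num] at hlim
    refine hlim.congr fun n => ?_
    rw [hBe, hBe]
    simp only [div_eq_mul_inv, mul_inv, inv_inv]
    ring
  · have hsub : Tendsto (fun n : ℕ => 2 * n + 1) atTop atTop :=
      tendsto_atTop_mono (fun n => show n ≤ 2 * n + 1 by omega) tendsto_id
    refine (hratio.comp hsub).congr fun n => ?_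
    simp only [Function.comp]
    rw [show (2 * n + 1 + 1) / 2 = n + 1 by omega, show (2 * n + 1) / 2 = n by omega,
      show (2 * n + 1 + 1 - 1) / 2 = n by omega, show (2 * n + 1 - 1) / 2 = n by omega]
    push_cast
    rw [show (2 : ℝ) * n + 1 + 1 = 2 * n + 2 by ring, ← add_assoc]
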